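/- **Setting.** Let $G$ be a compact group and $\widehat G$ the set of equivalence classes of its continuous irreducible unitary representations (all finite-dimensional; $d_\pi=\dim\pi$; a representative and an orthonormal basis are fixed in each class). Let $H=\bigoplus_{\pi\in\widehat G}\ell^2_{d_\pi}$, with the summand of $\pi$ repeated $d_\pi$ times, let $\lambda(s)=\bigoplus_{\pi}\overline{\pi}(s)$ on $H$ (again with repetitions; this is the left regular representation up to unitary equivalence), and let $VN(G)=\{\lambda(s)\}''\subseteq B(H)$ and $VN(G\times G)=\{\lambda(s)\otimes\lambda(t)\}''\subseteq B(H\otimes_2H)$. Let $\Gamma:VN(G)\to VN(G\times G)$ be the co-multiplication, i.e. the normal $*$-homomorphism with $\Gamma(\lambda(s))=\lambda(s)\otimes\lambda(s)$ for all $s\in G$. **Weights.** A closed densely defined positive (self-adjoint) operator $W$ on $H$, affiliated to $VN(G)$ and with a bounded inverse $W^{-1}\in VN(G)$, is a *weight on the dual of $G$* if there is an increasing net of projections $(E_i)$ in $VN(G)$ such that 0. $\bigcup_iE_i(H)$ is dense in $H$ and contained in the domain of $W$, all $WE_i$ are bounded self-adjoint operators in $VN(G)$, and $\mathcal D'=\bigcup_i\Gamma(E_i)(H\otimes_2H)$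 is dense in $H\otimes_2H$; let then $\Gamma(W)$ be the closure of the operator on $\mathcal D'$ given by $k\mapsto\Gamma(WE_i)k$ for $k\in\Gamma(E_i)(H\otimes_2H)$; 1. $\mathcal D_0=\{x\in H\otimes_2H:(W^{-1}\otimes W^{-1})x\in\mathcal D'\}$ is dense; 2. $\Gamma(W)(W^{-1}\otimes W^{-1})$ is bounded on $\mathcal D_0$, and its bounded extension $T$ to $H\otimes_2 H$ satisfies $T\le 1$; 3. $VN(G)W^{-1}$ is $w^*$-dense in $VN(G)$. The weight $W$ is *central* if the net can be chosen so that in addition $WE_i\in VN(G)'$ for all $i$. **Theorem.** Let $\delta>0$ and $\omega:\widehat G\to(\delta,\infty)$. Let $W=\bigoplus_{\pi\in\widehat G}\omega(\pi)1_{M_{d_\pi}}$ be the closure of the operator that is defined on the vectors of $H$ with only finitely many nonzero components and multiplies the components belonging to $\pi$ by $\omega(\pi)$. Then $W$ is a central weight on the dual of $G$ if and only if $$\omega(\sigma)\le\omega(\pi)\,\omega(\pi')$$ for all $\sigma,\pi,\pi'\in\widehat G$ with $\sigma\in\operatorname{supp}(\pi\otimes\pi')$, i.e. such that $\sigma$ appears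 in the decomposition of $\pi\otimes\pi'$ into irreducible representations. -/

import Mathlib

universe u v

open scoped TensorProduct Kronecker InnerProductSpace

namespace BeurlingFourier

noncomputable section

/-! ### Von Neumann algebras and the ultraweak topology -/

section VonNeumann

variable {H : Type u} [NormedAddCommGroup H] [InnerProductSpace ℂ H] [CompleteSpace H]

/-- The von Neumann algebra generated by a set `S` of bounded operators: the double commutant of
`S ∪ S*`. -/
def generatedVN (S : Set (H →L[ℂ] H)) : VonNeumannAlgebra H where
  toStarSubalgebra :=
    StarSubalgebra.centralizer ℂ (StarSubalgebra.centralizer ℂ S : Set (H →L[ℂ] H))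
  centralizer_centralizer' := by
    change Set.centralizer (Set.centralizer ((StarSubalgebra.centralizer ℂ
      (StarSubalgebra.centralizer ℂ S : Set (H →L[ℂ] H)) : Set (H →L[ℂ] H)))) =
      ((StarSubalgebra.centralizer ℂ
      (StarSubalgebra.centralizer ℂ S : Set (H →L[ℂ] H)) : Set (H →L[ℂ] H)))
    rw [StarSubalgebra.coe_centralizer_centralizer, Set.centralizer_centralizer_centralizer]

theorem subset_generatedVN (S : Set (H →L[ℂ] H)) {A : H →L[ℂ] H} (hA : A ∈ S) :
    A ∈ (generatedVN S).toStarSubalgebra :=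
  StarAlgebra.adjoin_le_centralizer_centralizer ℂ S (StarAlgebra.subset_adjoin ℂ S hA)

variable (H) in
/-- The ultraweak (σ-weak, w*-) topology of `B(H)`: the coarsest topology that makes all the
functionals `A ↦ ∑ ⟪xₙ, A yₙ⟫` with `∑ ‖xₙ‖² < ∞` and `∑ ‖yₙ‖² < ∞` continuous. -/
abbrev ultraweakTopology : TopologicalSpace (H →L[ℂ] H) :=
  ⨅ p : {p : (ℕ → H) × (ℕ → H) //
      (Summable fun n => ‖p.1 n‖ ^ 2) ∧ (Summable fun n => ‖p.2 n‖ ^ 2)},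
    TopologicalSpace.induced (fun A : H →L[ℂ] H => ∑' n, ⟪p.1.1 n, A (p.1.2 n)⟫_ℂ) inferInstance

/-- The w*-topology of a von Neumann algebra, as the dual of its predual. -/
abbrev weakStarTopology (M : VonNeumannAlgebra H) : TopologicalSpace M.toStarSubalgebra :=
  TopologicalSpace.induced (fun A => (A : H →L[ℂ] H)) (ultraweakTopology H)

/-- `W` is affiliated to `M`: `U W U* = W` for all unitaries `U` in the commutant of `M`. -/
def IsAffiliated (M : VonNeumannAlgebra H) (W : H →ₗ.[ℂ] H) : Prop :=
  ∀ U : H →L[ℂ] H, U ∈ unitary (H →L[ℂ] H) → U ∈ M.commutant →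
    ∀ x y : H, (U x, U y) ∈ W.graph ↔ (x, y) ∈ W.graph

/-- `S` is the bounded inverse of `W`: `W S = id` and `S W ⊆ id`. -/
def IsBoundedInverse (W : H →ₗ.[ℂ] H) (S : H →L[ℂ] H) : Prop :=
  (∀ x : H, (S x, x) ∈ W.graph) ∧ ∀ x y : H, (x, y) ∈ W.graph → S y = x

/-- `W` is a positive (possibly unbounded) self-adjoint operator. -/
def IsPositiveOperator (W : H →ₗ.[ℂ] H) : Prop :=
  IsSelfAdjoint W ∧ ∀ x : W.domain, 0 ≤ (⟪W x, (x : H)⟫_ℂ).re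

end VonNeumann

/-! ### Extension of `*`-homomorphisms to unbounded operators -/

section Extension

variable {H : Type u} [NormedAddCommGroup H] [InnerProductSpace ℂ H] [CompleteSpace H]
  {K : Type v} [NormedAddCommGroup K] [InnerProductSpace ℂ K] [CompleteSpace K]
  {M : VonNeumannAlgebra H} {N : VonNeumannAlgebra K}

/-- The situation in which `Φ : M → N` can be applied to the closed operator `W`: there is an
increasing net of projections `E i` in `M` such that the union `D` of their ranges is dense and
lies in the domain of `W`, the operators `WE i = W (E i)` are bounded, self-adjoint and in `M`, and
the union `D'` of the ranges of the `Φ (E i)` is dense. -/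
structure IsExtendable (Φ : M.toStarSubalgebra →⋆ₐ[ℂ] N.toStarSubalgebra) (W : H →ₗ.[ℂ] H)
    {ι : Type*} [Preorder ι] (E WE : ι → M.toStarSubalgebra) : Prop where
  nonempty : Nonempty ι
  directed : IsDirected ι (· ≤ ·)
  projection : ∀ i, IsStarProjection (E i : H →L[ℂ] H)
  monotone : ∀ i j, i ≤ j → (E i : H →L[ℂ] H) ≤ (E j : H →L[ℂ] H)
  dense_D : Dense (⋃ i, Set.range (E i : H →L[ℂ] H))
  closed : W.IsClosed
  mem_graph : ∀ i x, ((E i : H →L[ℂ] H) x, (WE i : H →L[ℂ] H) x) ∈ W.graph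
  selfAdjoint : ∀ i, IsSelfAdjoint (WE i : H →L[ℂ] H)
  dense_D' : Dense (⋃ i, Set.range (Φ (E i) : K →L[ℂ] K))

/-- The operator `Φ(W)`: the closure of the operator `B` on `D' = ⋃ i, Φ(E i)(K)` that is given by
`B k = Φ(W (E i)) k` for `k ∈ Φ(E i)(K)`. (The supremum of the graphs is their union, as the net
is increasing.) -/
def extension (Φ : M.toStarSubalgebra →⋆ₐ[ℂ] N.toStarSubalgebra)
    {ι : Type*} (E WE : ι → M.toStarSubalgebra) : K →ₗ.[ℂ] K :=
  (Submodule.toLinearPMap (⨆ i, (LinearMap.range (Φ (E i) : K →L[ℂ] K).toLinearMap).map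
    (LinearMap.prod LinearMap.id (Φ (WE i) : K →L[ℂ] K).toLinearMap))).closure

end Extension

/-! ### Weights on the dual of a group -/

section Weight

variable {H : Type u} [NormedAddCommGroup H] [InnerProductSpace ℂ H] [CompleteSpace H]

variable (H) in
/-- The Hilbert space tensor product `H ⊗₂ H`. -/
abbrev HilbertSq : Type u := UniformSpace.Completion (H ⊗[ℂ] H)

/-- The bounded operator `A ⊗ B` on `H ⊗₂ H`. -/
def tensorOp (A B : H →L[ℂ] H) : HilbertSq H →L[ℂ] HilbertSq H :=
  (TensorProduct.mapL A B).completion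

variable {G : Type v} [Group G]

/-- A unitary operator as a bounded operator. -/
def unitaryOp (lam : G →* (H ≃ₗᵢ[ℂ] H)) (s : G) : H →L[ℂ] H :=
  (lam s).toLinearIsometry.toContinuousLinearMap

/-- The von Neumann algebra generated by a unitary representation `lam` of `G`; this is `VN(G)`
if `lam` is the left regular representation, up to multiplicities. -/
def VN (lam : G →* (H ≃ₗᵢ[ℂ] H)) : VonNeumannAlgebra H :=
  generatedVN (Set.range (unitaryOp lam))

/-- The von Neumann algebra on `H ⊗₂ H` generated by the operators `lam s ⊗ lam t`, i.e.
`VN(G × G)`. -/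
def VNSq (lam : G →* (H ≃ₗᵢ[ℂ] H)) : VonNeumannAlgebra (HilbertSq H) :=
  generatedVN (Set.range fun p : G × G => tensorOp (unitaryOp lam p.1) (unitaryOp lam p.2))

/-- `Γ : VN(G) → VN(G × G)` is the co-multiplication: the normal (w*-w*-continuous)
`*`-homomorphism with `Γ(lam s) = lam s ⊗ lam s`. There is at most one, since the linear span of the
`lam s` is w*-dense in `VN(G)`. -/
structure IsComultiplication (lam : G →* (H ≃ₗᵢ[ℂ] H))
    (Γ : (VN lam).toStarSubalgebra →⋆ₐ[ℂ] (VNSq lam).toStarSubalgebra) : Prop where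
  normal : @Continuous _ _ (weakStarTopology (VN lam)) (weakStarTopology (VNSq lam)) Γ
  map_lam : ∀ s : G, (Γ ⟨unitaryOp lam s, subset_generatedVN _ ⟨s, rfl⟩⟩ :
    HilbertSq H →L[ℂ] HilbertSq H) = tensorOp (unitaryOp lam s) (unitaryOp lam s)

/-- `W` is a weight on the dual of `G`, where `VN(G)` is represented on `H` through `lam`, `Γ` is
the co-multiplication, `E` is the net of projections that is used to define `Γ(W)`, `WE i` is
`W (E i)`, and `Winv` is the bounded inverse of `W`. -/
structure IsWeightAlong (lam : G →* (H ≃ₗᵢ[ℂ] H))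
    (Γ : (VN lam).toStarSubalgebra →⋆ₐ[ℂ] (VNSq lam).toStarSubalgebra) (W : H →ₗ.[ℂ] H)
    {ι : Type*} [Preorder ι] (E WE : ι → (VN lam).toStarSubalgebra)
    (Winv : (VN lam).toStarSubalgebra) : Prop where
  closed : W.IsClosed
  dense_domain : Dense (W.domain : Set H)
  positive : IsPositiveOperator W
  affiliated : IsAffiliated (VN lam) W
  inverse : IsBoundedInverse W (Winv : H →L[ℂ] H)
  comultiplication : IsComultiplication lam Γ
  extendable : IsExtendable Γ W E WE
  /-- `D₀ = {x | (W⁻¹ ⊗ W⁻¹) x ∈ D'}` is dense. -/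
  dense_D₀ : Dense {x : HilbertSq H | tensorOp (Winv : H →L[ℂ] H) (Winv : H →L[ℂ] H) x ∈
    ⋃ i, Set.range (Γ (E i) : HilbertSq H →L[ℂ] HilbertSq H)}
  /-- `Γ(W) (W⁻¹ ⊗ W⁻¹)` is bounded on `D₀`, and its extension `T` to `H ⊗₂ H` satisfies `T ≤ 1`. -/
  bounded_le_one : ∃ T : HilbertSq H →L[ℂ] HilbertSq H,
    (∀ x, tensorOp (Winv : H →L[ℂ] H) (Winv : H →L[ℂ] H) x ∈
        (⋃ i, Set.range (Γ (E i) : HilbertSq H →L[ℂ] HilbertSq H)) →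
      (tensorOp (Winv : H →L[ℂ] H) (Winv : H →L[ℂ] H) x, T x) ∈ (extension Γ E WE).graph) ∧
    T ≤ 1
  /-- `VN(G) W⁻¹` is w*-dense in `VN(G)`. -/
  dense_mul_inv : @Dense _ (weakStarTopology (VN lam))
    (Set.range fun A : (VN lam).toStarSubalgebra => A * Winv)

/-- `W` is a weight on the dual of `G`. -/
def IsWeight (lam : G →* (H ≃ₗᵢ[ℂ] H)) (W : H →ₗ.[ℂ] H) : Prop :=
  ∃ (Γ : (VN lam).toStarSubalgebra →⋆ₐ[ℂ] (VNSq lam).toStarSubalgebra)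
    (ι : Type u) (_ : Preorder ι) (E WE : ι → (VN lam).toStarSubalgebra)
    (Winv : (VN lam).toStarSubalgebra), IsWeightAlong lam Γ W E WE Winv

/-- `W` is a central weight on the dual of `G`: moreover all `W (E i)` are in `VN(G)'`. -/
def IsCentralWeight (lam : G →* (H ≃ₗᵢ[ℂ] H)) (W : H →ₗ.[ℂ] H) : Prop :=
  ∃ (Γ : (VN lam).toStarSubalgebra →⋆ₐ[ℂ] (VNSq lam).toStarSubalgebra)
    (ι : Type u) (_ : Preorder ι) (E WE : ι → (VN lam).toStarSubalgebra)
    (Winv : (VN lam).toStarSubalgebra), IsWeightAlong lam Γ W E WE Winv ∧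
      ∀ i, (WE i : H →L[ℂ] H) ∈ (VN lam).commutant

end Weight

/-! ### Finite-dimensional unitary representations and the dual of a compact group -/

section Reps

variable (G : Type u) [Group G] [TopologicalSpace G]

/-- Continuous unitary representations of `G` on `ℂ^ι`, in matrix form. -/
abbrev MatrixRep (ι : Type*) [Fintype ι] [DecidableEq ι] := G →ₜ* Matrix.unitaryGroup ι ℂ

variable {G}

section
variable {ι κ : Type*} [Fintype ι] [DecidableEq ι] [Fintype κ] [DecidableEq κ]

/-- The matrix `ρ(s)`. -/
abbrev MatrixRep.mat (ρ : MatrixRep G ι) (s : G) : Matrix ι ι ℂ := (ρ s : Matrix ι ι ℂ)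

/-- `ℂ^ι ≠ 0` has no invariant subspaces besides `0` and itself. -/
def MatrixRep.IsIrreducible (ρ : MatrixRep G ι) : Prop :=
  Nonempty ι ∧ ∀ p : Submodule ℂ (ι → ℂ),
    (∀ s : G, ∀ v ∈ p, (ρ.mat s).mulVec v ∈ p) → p = ⊥ ∨ p = ⊤

/-- Unitary equivalence. -/
def MatrixRep.Equivalent (ρ : MatrixRep G ι) (τ : MatrixRep G κ) : Prop :=
  ∃ U : Matrix κ ι ℂ, U.conjTranspose * U = 1 ∧ U * U.conjTranspose = 1 ∧
    ∀ s : G, U * ρ.mat s = τ.mat s * U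

/-- The conjugate representation (entrywise complex conjugates). -/
def MatrixRep.conj (ρ : MatrixRep G ι) : MatrixRep G ι where
  toFun s := ⟨(ρ.mat s).map (starRingEnd ℂ), by
    have h := (Matrix.mem_unitaryGroup_iff).1 (ρ s).2
    rw [Matrix.mem_unitaryGroup_iff]
    have h2 := congrArg (fun A : Matrix ι ι ℂ => A.map (starRingEnd ℂ)) h
    simp only [Matrix.map_mul] at h2
    rw [Matrix.map_one _ (map_zero _) (map_one _)] at h2
    exact h2⟩
  map_one' := by
    apply Subtype.ext
    simp [MatrixRep.mat, Matrix.map_one]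
  map_mul' s t := by
    apply Subtype.ext
    simp [MatrixRep.mat, Matrix.map_mul]
  continuous_toFun := by
    have h : Continuous fun s => ρ.mat s := continuous_subtype_val.comp ρ.continuous_toFun
    exact Continuous.subtype_mk (h.matrix_map Complex.continuous_conj) _

/-- The tensor product representation `ρ ⊗ τ` (Kronecker products). -/
def MatrixRep.tensor (ρ : MatrixRep G ι) (τ : MatrixRep G κ) : MatrixRep G (ι × κ) where
  toFun s := ⟨ρ.mat s ⊗ₖ τ.mat s, Matrix.kronecker_mem_unitary (ρ s).2 (τ s).2⟩
  map_one' := by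
    apply Subtype.ext
    simp [MatrixRep.mat]
  map_mul' s t := by
    apply Subtype.ext
    simp [MatrixRep.mat, Matrix.mul_kronecker_mul]
  continuous_toFun := by
    have h : Continuous fun s => ρ.mat s := continuous_subtype_val.comp ρ.continuous_toFun
    have h' : Continuous fun s => τ.mat s := continuous_subtype_val.comp τ.continuous_toFun
    refine Continuous.subtype_mk (continuous_matrix fun i j => ?_) _
    exact (h.matrix_elem i.1 j.1).mul (h'.matrix_elem i.2 j.2)

/-- The direct sum of finitely many representations. -/
def MatrixRep.directSum {n : ℕ} {d : Fin n → ℕ} (τ : ∀ i, MatrixRep G (Fin (d i))) :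
    MatrixRep G (Σ i, Fin (d i)) where
  toFun s := ⟨Matrix.blockDiagonal' fun i => (τ i).mat s, by
    rw [Matrix.mem_unitaryGroup_iff, Matrix.star_eq_conjTranspose,
      Matrix.blockDiagonal'_conjTranspose, ← Matrix.blockDiagonal'_mul,
      ← Matrix.blockDiagonal'_one]
    congr 1
    funext i
    exact (Matrix.mem_unitaryGroup_iff).1 (τ i s).2⟩
  map_one' := by
    apply Subtype.ext
    simp only [MatrixRep.mat, map_one]
    exact Matrix.blockDiagonal'_one
  map_mul' s t := by
    apply Subtype.ext
    simp [MatrixRep.mat, ← Matrix.blockDiagonal'_mul]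
  continuous_toFun := by
    refine Continuous.subtype_mk (Continuous.matrix_blockDiagonal' ?_) _
    exact continuous_pi fun i => continuous_subtype_val.comp (τ i).continuous_toFun

/-- The bijective isometries of `ℂ^ι` that correspond to the unitary matrices `ρ(s)`. -/
def MatrixRep.isometries (ρ : MatrixRep G ι) :
    G →* (EuclideanSpace ℂ ι ≃ₗᵢ[ℂ] EuclideanSpace ℂ ι) :=
  (Unitary.linearIsometryEquiv.toMonoidHom.comp
    (Unitary.map (StarMulEquiv.toStarMonoidHom
      { (Matrix.toEuclideanCLM (n := ι) (𝕜 := ℂ)) with })).toMonoidHom).comp ρ.toMonoidHom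

theorem MatrixRep.isometries_apply (ρ : MatrixRep G ι) (s : G) (x : EuclideanSpace ℂ ι) :
    ρ.isometries s x = WithLp.toLp 2 ((ρ.mat s).mulVec x.ofLp) := rfl

end

variable (G) in
/-- A continuous irreducible unitary representation of `G` on some `ℂ^d`. -/
structure Irrep where
  dim : ℕ
  rep : MatrixRep G (Fin dim)
  irreducible : rep.IsIrreducible

variable (G) in
instance Irrep.setoid : Setoid (Irrep G) where
  r ρ τ := ρ.rep.Equivalent τ.rep
  iseqv :=
    { refl := fun ρ => ⟨1, by simp, by simp, by simp⟩
      symm := by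
        rintro ρ τ ⟨U, h1, h2, h⟩
        refine ⟨U.conjTranspose, by simpa using h2, by simpa using h1, fun s => ?_⟩
        calc U.conjTranspose * τ.rep.mat s
            = U.conjTranspose * (τ.rep.mat s * U) * U.conjTranspose := by
              rw [Matrix.mul_assoc, Matrix.mul_assoc, h2, Matrix.mul_one]
          _ = ρ.rep.mat s * U.conjTranspose := by
              rw [← h, ← Matrix.mul_assoc, h1, Matrix.one_mul]
      trans := by
        rintro ρ τ σ ⟨U, h1, h2, h⟩ ⟨V, k1, k2, k⟩
        refine ⟨V * U, ?_, ?_, fun s => ?_⟩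
        · rw [Matrix.conjTranspose_mul, Matrix.mul_assoc, ← Matrix.mul_assoc V.conjTranspose, k1,
            Matrix.one_mul, h1]
        · rw [Matrix.conjTranspose_mul, Matrix.mul_assoc, ← Matrix.mul_assoc U, h2,
            Matrix.one_mul, k2]
        · rw [Matrix.mul_assoc, h, ← Matrix.mul_assoc, k, Matrix.mul_assoc] }

variable (G) in
/-- The dual `Ĝ` of a compact group: the equivalence classes of its continuous irreducible unitary
representations, all of which are finite-dimensional. -/
def Dual : Type u := Quotient (Irrep.setoid G)

/-- The dimension `d_π`. -/
def Dual.dim (π : Dual G) : ℕ := (Quotient.out π).dim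

/-- A fixed representative of the class `π`, in a fixed orthonormal basis. -/
def Dual.rep (π : Dual G) : MatrixRep G (Fin π.dim) := (Quotient.out π).rep

/-- The support of `ρ`: the classes that appear in a decomposition of `ρ` into irreducible
representations. -/
def supp {κ : Type*} [Fintype κ] [DecidableEq κ] (ρ : MatrixRep G κ) : Set (Dual G) :=
  {σ | ∃ (n : ℕ) (τ : Fin n → Dual G),
    ρ.Equivalent (MatrixRep.directSum fun i => (τ i).rep) ∧ ∃ i, τ i = σ}

end Reps

/-! ### The representation of `VN(G)` for compact `G`, and the operators `⨁ ω(π) 1` -/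

section Compact

section Block

variable {ι : Type*} {V : ι → Type*} [∀ i, NormedAddCommGroup (V i)]
  [∀ i, InnerProductSpace ℂ (V i)]

/-- The direct sum of isometries on the Hilbert space direct sum. -/
def blockIsometry (e : ∀ i, V i ≃ₗᵢ[ℂ] V i) : lp V 2 ≃ₗᵢ[ℂ] lp V 2 where
  toFun f := ⟨fun i => e i (f i), (lp.memℓp f).mono' fun i => ((e i).norm_map (f i)).le⟩
  invFun f := ⟨fun i => (e i).symm (f i),
    (lp.memℓp f).mono' fun i => ((e i).symm.norm_map (f i)).le⟩
  map_add' f g := by ext i : 2; exact map_add (e i) (f i) (g i)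
  map_smul' c f := by ext i : 2; exact map_smul (e i) c (f i)
  left_inv f := by ext i : 2; simp
  right_inv f := by ext i : 2; simp
  norm_map' f := by
    refine le_antisymm (lp.norm_mono two_ne_zero fun i => ?_) (lp.norm_mono two_ne_zero fun i => ?_)
    · exact ((e i).norm_map (f i)).le
    · exact ((e i).norm_map (f i)).ge

/-- The Hilbert space direct sum of a family of unitary representations. -/
def blockRep {G : Type*} [Group G] (ρ : ∀ i, G →* (V i ≃ₗᵢ[ℂ] V i)) :
    G →* (lp V 2 ≃ₗᵢ[ℂ] lp V 2) where
  toFun s := blockIsometry fun i => ρ i s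
  map_one' := by
    ext f i
    change (ρ i 1) (f i) = f i
    rw [map_one]
    rfl
  map_mul' s t := by
    ext f i
    change (ρ i (s * t)) (f i) = (ρ i s) ((ρ i t) (f i))
    rw [map_mul]
    rfl

end Block

variable (G : Type u) [Group G] [TopologicalSpace G]

/-- The Hilbert space `⨁ ℓ²_{d_π}` over `π ∈ Ĝ`, where the summand of `π` is repeated `d_π` times. -/
abbrev RegSpace : Type u :=
  lp (fun i : (Σ π : Dual G, Fin π.dim) => EuclideanSpace ℂ (Fin i.1.dim)) 2

/-- The left regular representation of a compact group in its Peter-Weyl form: the direct sum of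
the conjugates of all `π ∈ Ĝ`, each repeated `d_π` times. -/
def regularRep : G →* (RegSpace G ≃ₗᵢ[ℂ] RegSpace G) :=
  blockRep fun i : (Σ π : Dual G, Fin π.dim) => i.1.rep.conj.isometries

variable {G}

/-- The operator that multiplies the blocks of `π` by `ω(π)`, defined on the union `D` of the
`E_F(H)` for finite `F ⊆ Ĝ`, i.e. on the vectors with finitely many nonzero blocks. -/
def centralCore (ω : Dual G → ℝ) : RegSpace G →ₗ.[ℂ] RegSpace G where
  domain :=
    { carrier := {h | {i | h i ≠ 0}.Finite}
      zero_mem' := by simp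
      add_mem' := by
        intro a b ha hb
        refine Set.Finite.subset (Set.Finite.union ha hb) fun i hi => ?_
        by_contra hc
        simp only [Set.mem_union, Set.mem_ofPred_eq, not_or, not_not] at hc
        exact hi (by simp [hc.1, hc.2])
      smul_mem' := by
        intro c a ha
        refine Set.Finite.subset ha fun i hi hc => hi ?_
        simp [hc] }
  toFun :=
    { toFun := fun h => ⟨fun i => (ω i.1 : ℂ) • (h : RegSpace G) i, by
        refine (memℓp_zero (Set.Finite.subset h.2 fun i hi hc => hi ?_)).of_exponent_ge zero_le
        simp [hc]⟩
      map_add' := by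
        intro a b
        ext i : 2
        exact smul_add (ω i.1 : ℂ) ((a : RegSpace G) i) ((b : RegSpace G) i)
      map_smul' := by
        intro c a
        ext i : 2
        exact smul_comm (ω i.1 : ℂ) c ((a : RegSpace G) i) }

/-- The operator `W = ⨁ ω(π) 1` on `⨁ ℓ²_{d_π}`: the closure of `centralCore ω`. -/
def centralOperator (ω : Dual G → ℝ) : RegSpace G →ₗ.[ℂ] RegSpace G := (centralCore ω).closure

end Compact

end

end BeurlingFourier

-- The theorem holds because the co-multiplication and $W^{-1}\otimes W^{-1}$ are diagonalised
-- simultaneously by the decomposition of $H\otimes_2H$ into irreducible subrepresentations of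
-- $\lambda\otimes\lambda$. A summand of class $\sigma$ can be chosen inside the tensor product of a
-- single block of $\pi$ and a single block of $\pi'$, and then
-- $\sigma\in\operatorname{supp}(\pi\otimes\pi')$. On it $\Gamma(A)$ acts as the $\sigma$-block of
-- $A$, so $\Gamma(W)$ is the scalar $\omega(\sigma)$, while $W^{-1}\otimes W^{-1}$ is the scalar
-- $\omega(\pi)^{-1}\omega(\pi')^{-1}$. Hence $T$ is multiplication by
-- $\omega(\sigma)/(\omega(\pi)\omega(\pi'))$, and $T\le1$ says that all these numbers are at most
-- $1$.
--
-- Necessity has to work with an arbitrary net $(E_i)$ and an arbitrary co-multiplication $\Gamma$.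
-- If $R:H\to H\otimes_2H$ intertwines $\lambda$ and $\lambda\otimes\lambda$, then $\Gamma(A)R=RA$
-- for $A=\lambda(s)$, hence for every $A\in VN(G)$ by normality and the w*-density of the span of
-- the $\lambda(s)$ (`IsComultiplication.apply_intertwiner`, `dense_span_unitaryOp`). An embedding
-- of $\sigma$ into $\pi\otimes\pi'$ provides such an $R$. Since no $E_i$ need fix a given vector,
-- the eigenvalue equation for $\Gamma(W)$ is used in weak form, paired with $Rv$, which passes to
-- the closure of the graph and then from $\mathcal D_0$ to all of $H\otimes_2H$
-- (`IsWeightAlong.mul_le_one`).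
--
-- For sufficiency, complete reducibility (`exists_equivalent_directSum`) gives a full decomposition
-- (`nonempty_fusionSystem`). The co-multiplication is built from it blockwise
-- (`FusionSystem.comult`), the net consists of the projections onto finitely many classes, and
-- every condition is checked coordinatewise (`isWeightAlong_of_le`).

universe w

namespace BeurlingFourier

/-! ### Schur's lemma and complete reducibility of finite-dimensional unitary representations -/

section RepresentationTheory

open Matrix
open scoped ComplexOrder

variable {G : Type u} [Group G] [TopologicalSpace G]

section
variable {ι κ : Type*} [Fintype ι] [DecidableEq ι] [Fintype κ] [DecidableEq κ]

theorem MatrixRep.mat_mul (ρ : MatrixRep G ι) (s t : G) : ρ.mat (s * t) = ρ.mat s * ρ.mat t := by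
  simp [MatrixRep.mat]

theorem MatrixRep.mat_one (ρ : MatrixRep G ι) : ρ.mat 1 = 1 := by
  simp [MatrixRep.mat]

theorem MatrixRep.mat_mul_conjTranspose (ρ : MatrixRep G ι) (s : G) :
    ρ.mat s * (ρ.mat s)ᴴ = 1 :=
  (Matrix.mem_unitaryGroup_iff).1 (ρ s).2

theorem MatrixRep.mat_inv (ρ : MatrixRep G ι) (s : G) : ρ.mat s⁻¹ = (ρ.mat s)ᴴ := by
  have h : ρ.mat s⁻¹ * ρ.mat s = 1 := by rw [← ρ.mat_mul, inv_mul_cancel, ρ.mat_one]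
  calc ρ.mat s⁻¹ = ρ.mat s⁻¹ * (ρ.mat s * (ρ.mat s)ᴴ) := by
        rw [ρ.mat_mul_conjTranspose, Matrix.mul_one]
    _ = (ρ.mat s)ᴴ := by rw [← Matrix.mul_assoc, h, Matrix.one_mul]

/-- The adjoint of an intertwiner is an intertwiner. -/
theorem MatrixRep.intertwine_conjTranspose {ρ : MatrixRep G ι} {τ : MatrixRep G κ}
    {X : Matrix κ ι ℂ} (h : ∀ s, X * ρ.mat s = τ.mat s * X) (s : G) :
    Xᴴ * τ.mat s = ρ.mat s * Xᴴ := by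
  have h1 := congrArg conjTranspose (h s⁻¹)
  rw [conjTranspose_mul, conjTranspose_mul, mat_inv, mat_inv, conjTranspose_conjTranspose,
    conjTranspose_conjTranspose] at h1
  exact h1.symm

/-- **Schur's lemma**: an operator that commutes with an irreducible representation is scalar. -/
theorem MatrixRep.IsIrreducible.eq_smul_one {ρ : MatrixRep G ι} (hρ : ρ.IsIrreducible)
    {X : Matrix ι ι ℂ} (h : ∀ s, X * ρ.mat s = ρ.mat s * X) : ∃ c : ℂ, X = c • 1 := by
  obtain ⟨hne, hirr⟩ := hρ
  obtain ⟨c, hc⟩ := Module.End.exists_eigenvalue (Matrix.toLin' X)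
  refine ⟨c, ?_⟩
  have hinv : ∀ s, ∀ v ∈ Module.End.eigenspace (Matrix.toLin' X) c,
      (ρ.mat s).mulVec v ∈ Module.End.eigenspace (Matrix.toLin' X) c := fun s v hv => by
    rw [Module.End.mem_eigenspace_iff, Matrix.toLin'_apply] at hv ⊢
    rw [Matrix.mulVec_mulVec, h, ← Matrix.mulVec_mulVec, hv, Matrix.mulVec_smul]
  rcases hirr _ hinv with h0 | h0
  · exact absurd h0 hc
  · apply Matrix.toLin'.injective
    refine LinearMap.ext fun v => ?_
    have hv : v ∈ Module.End.eigenspace (Matrix.toLin' X) c := h0 ▸ Submodule.mem_top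
    rw [Module.End.mem_eigenspace_iff] at hv
    rw [hv]
    simp

/-- **Schur's lemma**: irreducible representations with a nonzero intertwiner are equivalent. -/
theorem MatrixRep.IsIrreducible.equivalent_of_intertwine {ρ : MatrixRep G ι} {τ : MatrixRep G κ}
    (hρ : ρ.IsIrreducible) (hτ : τ.IsIrreducible) {X : Matrix κ ι ℂ}
    (h : ∀ s, X * ρ.mat s = τ.mat s * X) (hX : X ≠ 0) : ρ.Equivalent τ := by
  have h' := MatrixRep.intertwine_conjTranspose h
  obtain ⟨c, hc⟩ := hρ.eq_smul_one (X := Xᴴ * X) fun s => by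
    rw [Matrix.mul_assoc, h, ← Matrix.mul_assoc, h', Matrix.mul_assoc]
  obtain ⟨d, hd⟩ := hτ.eq_smul_one (X := X * Xᴴ) fun s => by
    rw [Matrix.mul_assoc, h', ← Matrix.mul_assoc, h, Matrix.mul_assoc]
  -- Both scalars appear in $XX^*X$, and $X\neq0$.
  have hcd : d = c := by
    have h1 : (X * Xᴴ) * X = X * (Xᴴ * X) := Matrix.mul_assoc _ _ _
    rw [hc, hd, Matrix.smul_mul, Matrix.one_mul, Matrix.mul_smul, Matrix.mul_one] at h1
    have h2 : (d - c) • X = 0 := by rw [sub_smul, h1, sub_self]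
    rcases smul_eq_zero.1 h2 with h3 | h3
    · exact sub_eq_zero.1 h3
    · exact absurd h3 hX
  subst hcd
  have hne := hρ.1
  obtain ⟨i⟩ := hne
  -- The scalar is the squared norm of a column of $X$. It is nonzero because $X$ is, so $r^{-1/2}X$
  -- will be the unitary equivalence.
  have hpos : ∃ r : ℝ, 0 ≤ r ∧ d = r := by
    have h1 : (Xᴴ * X) i i = d := by simp [hc]
    refine ⟨∑ k, ‖X k i‖ ^ 2, Finset.sum_nonneg fun _ _ => sq_nonneg _, ?_⟩
    rw [← h1, Matrix.mul_apply]
    push_cast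
    refine Finset.sum_congr rfl fun k _ => ?_
    rw [Matrix.conjTranspose_apply, ← Complex.conj_mul']
    rfl
  obtain ⟨r, hr, rfl⟩ := hpos
  have hr0 : r ≠ 0 := by
    rintro rfl
    refine hX (Matrix.conjTranspose_mul_self_eq_zero.1 ?_)
    rw [hc]; simp
  have hrpos : 0 < r := lt_of_le_of_ne hr (Ne.symm hr0)
  have hsq : ((Real.sqrt r)⁻¹ : ℂ) * ((Real.sqrt r)⁻¹ : ℂ) * r = 1 := by
    have h1 : Real.sqrt r * Real.sqrt r = r := Real.mul_self_sqrt hr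
    have h2 : Real.sqrt r ≠ 0 := (Real.sqrt_pos.2 hrpos).ne'
    have h3 : (Real.sqrt r)⁻¹ * (Real.sqrt r)⁻¹ * r = 1 := by
      field_simp
      nlinarith
    exact_mod_cast h3
  have hstar : star ((Real.sqrt r)⁻¹ : ℂ) = ((Real.sqrt r)⁻¹ : ℂ) := by
    simp
  refine ⟨((Real.sqrt r)⁻¹ : ℂ) • X, ?_, ?_, fun s => ?_⟩
  · rw [conjTranspose_smul, hstar, Matrix.smul_mul, Matrix.mul_smul, hc, smul_smul, smul_smul, hsq,
      one_smul]
  · rw [conjTranspose_smul, hstar, Matrix.smul_mul, Matrix.mul_smul, hd, smul_smul, smul_smul, hsq,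
      one_smul]
  · rw [Matrix.smul_mul, Matrix.mul_smul, h]

end

theorem Dual.irreducible (π : Dual G) : π.rep.IsIrreducible := (Quotient.out π).irreducible

theorem Dual.dim_pos (π : Dual G) : 0 < π.dim :=
  Fin.pos_iff_nonempty.2 π.irreducible.1

theorem Dual.eq_of_equivalent {π σ : Dual G} (h : π.rep.Equivalent σ.rep) : π = σ :=
  Quotient.out_equiv_out.1 h

theorem Dual.eq_of_intertwine {π σ : Dual G} {X : Matrix (Fin σ.dim) (Fin π.dim) ℂ}
    (h : ∀ s, X * π.rep.mat s = σ.rep.mat s * X) (hX : X ≠ 0) : π = σ :=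
  Dual.eq_of_equivalent (π.irreducible.equivalent_of_intertwine σ.irreducible h hX)

variable {κ : Type*} [Fintype κ] [DecidableEq κ]

/-- A subrepresentation, restricted to an orthonormal basis of its space. -/
noncomputable def MatrixRep.compress (ρ : MatrixRep G κ) {ι : Type*} [Fintype ι] [DecidableEq ι]
    (B : Matrix κ ι ℂ) (hB : Bᴴ * B = 1) (h : ∀ s, B * (Bᴴ * (ρ.mat s * B)) = ρ.mat s * B) :
    MatrixRep G ι where
  toFun s := ⟨Bᴴ * (ρ.mat s * B), by
    rw [Matrix.mem_unitaryGroup_iff, Matrix.star_eq_conjTranspose, conjTranspose_mul,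
      conjTranspose_mul, conjTranspose_conjTranspose, ← ρ.mat_inv]
    calc Bᴴ * (ρ.mat s * B) * (Bᴴ * ρ.mat s⁻¹ * B)
        = Bᴴ * (ρ.mat s * (B * (Bᴴ * (ρ.mat s⁻¹ * B)))) := by simp only [Matrix.mul_assoc]
      _ = Bᴴ * (ρ.mat s * ρ.mat s⁻¹ * B) := by rw [h, Matrix.mul_assoc]
      _ = 1 := by rw [← ρ.mat_mul, mul_inv_cancel, ρ.mat_one, Matrix.one_mul, hB]⟩
  map_one' := by
    apply Subtype.ext
    simp [ρ.mat_one, hB]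
  map_mul' s t := by
    apply Subtype.ext
    change Bᴴ * (ρ.mat (s * t) * B) = Bᴴ * (ρ.mat s * B) * (Bᴴ * (ρ.mat t * B))
    rw [Matrix.mul_assoc, Matrix.mul_assoc (ρ.mat s), h, ρ.mat_mul, Matrix.mul_assoc]
  continuous_toFun := by
    have h1 : Continuous fun s => ρ.mat s := continuous_subtype_val.comp ρ.continuous_toFun
    exact Continuous.subtype_mk
      (continuous_const.matrix_mul (h1.matrix_mul continuous_const)) _

/-- Every nonzero invariant subspace contains an irreducible subrepresentation. -/
theorem exists_irrep_embedding (ρ : MatrixRep G κ) (C : Submodule ℂ (κ → ℂ)) (hC : C ≠ ⊥)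
    (hinv : ∀ s : G, ∀ v ∈ C, (ρ.mat s).mulVec v ∈ C) :
    ∃ (σ : Dual G) (B : Matrix κ (Fin σ.dim) ℂ), Bᴴ * B = 1 ∧
      (∀ s, ρ.mat s * B = B * σ.rep.mat s) ∧ ∀ v, B.mulVec v ∈ C := by
  -- A minimal nonzero invariant subspace exists by finite dimension. The columns of `B` below form
  -- an orthonormal basis of it, so that $BB^*$ acts as the identity on `q`.
  obtain ⟨q, ⟨hq0, hqC, hqinv⟩, hmin⟩ := wellFounded_lt.has_min
    {q : Submodule ℂ (κ → ℂ) | q ≠ ⊥ ∧ q ≤ C ∧ ∀ s : G, ∀ v ∈ q, (ρ.mat s).mulVec v ∈ q}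
    ⟨C, hC, le_rfl, hinv⟩
  let q' : Submodule ℂ (EuclideanSpace ℂ κ) :=
    q.comap (WithLp.linearEquiv 2 ℂ (κ → ℂ)).toLinearMap
  let b := stdOrthonormalBasis ℂ q'
  let B : Matrix κ (Fin (Module.finrank ℂ q')) ℂ := fun a c => (b c : EuclideanSpace ℂ κ) a
  have hB : Bᴴ * B = 1 := by
    ext c c'
    have h1 := orthonormal_iff_ite.1 b.orthonormal c c'
    rw [Submodule.coe_inner, EuclideanSpace.inner_eq_star_dotProduct] at h1
    rw [Matrix.mul_apply, Matrix.one_apply, ← h1]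
    simp only [dotProduct, B, Pi.star_apply]
    exact Finset.sum_congr rfl fun k _ => mul_comm _ _
  have hsum : ∀ u, B.mulVec u = WithLp.linearEquiv 2 ℂ (κ → ℂ) ((∑ c, u c • b c : q') : _) := by
    intro u
    ext a
    simp [Matrix.mulVec, dotProduct, B, mul_comm]
  have hBq : ∀ u, B.mulVec u ∈ q := fun u => by
    rw [hsum]
    exact (∑ c, u c • b c : q').2
  have hsurj : ∀ w ∈ q, ∃ u, B.mulVec u = w := fun w hw => by
    refine ⟨fun c => b.repr ⟨WithLp.toLp 2 w, hw⟩ c, ?_⟩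
    rw [hsum, b.sum_repr]
    rfl
  have hproj : ∀ w ∈ q, B.mulVec (Bᴴ.mulVec w) = w := fun w hw => by
    obtain ⟨u, rfl⟩ := hsurj w hw
    rw [Matrix.mulVec_mulVec u Bᴴ, hB, Matrix.one_mulVec]
  have hcomm : ∀ s, B * (Bᴴ * (ρ.mat s * B)) = ρ.mat s * B := fun s => by
    apply Matrix.toLin'.injective
    refine LinearMap.ext fun u => ?_
    rw [Matrix.toLin'_apply, Matrix.toLin'_apply, ← Matrix.mulVec_mulVec, ← Matrix.mulVec_mulVec,
      ← Matrix.mulVec_mulVec]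
    exact hproj _ (hqinv s _ (hBq u))
  let τ := ρ.compress B hB hcomm
  have hτ : ∀ s, B * τ.mat s = ρ.mat s * B := hcomm
  have hBinj : ∀ u, B.mulVec u = 0 → u = 0 := fun u hu => by
    have h1 := congrArg (fun v => Bᴴ.mulVec v) hu
    simpa [Matrix.mulVec_mulVec, hB] using h1
  have hirr : τ.IsIrreducible := by
    constructor
    · by_contra hemp
      rw [not_nonempty_iff] at hemp
      refine hq0 ((Submodule.eq_bot_iff _).2 fun w hw => ?_)
      obtain ⟨u, rfl⟩ := hsurj w hw
      rw [Subsingleton.elim u 0, Matrix.mulVec_zero]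
    · intro p hp
      by_cases hp0 : p = ⊥
      · exact Or.inl hp0
      refine Or.inr ?_
      -- `B` carries an invariant subspace of the compression to an invariant subspace of `q`, where
      -- minimality decides.
      have hle : p.map B.mulVecLin ≤ q := by
        rintro _ ⟨u, -, rfl⟩
        exact hBq u
      have hnlt := hmin (p.map B.mulVecLin) ⟨fun h0 => hp0 ?_, hle.trans hqC, ?_⟩
      · have heq : p.map B.mulVecLin = q := by
          by_contra hne
          exact hnlt (lt_of_le_of_ne hle hne)
        refine (Submodule.eq_top_iff'.2 fun u => ?_)
        have hu : B.mulVec u ∈ p.map B.mulVecLin := heq ▸ hBq u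
        obtain ⟨u', hu', huu⟩ := hu
        have h2 : u' - u = 0 := hBinj _ (by
          rw [Matrix.mulVec_sub, sub_eq_zero]
          exact huu)
        rw [← sub_eq_zero.1 h2]
        exact hu'
      · refine (Submodule.eq_bot_iff _).2 fun u hu => hBinj u ?_
        have : B.mulVecLin u ∈ p.map B.mulVecLin := ⟨u, hu, rfl⟩
        rw [h0] at this
        exact this
      · rintro s _ ⟨u, hu, rfl⟩
        refine ⟨(τ.mat s).mulVec u, hp s u hu, ?_⟩
        rw [Matrix.mulVecLin_apply, Matrix.mulVecLin_apply, Matrix.mulVec_mulVec, hτ,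
          Matrix.mulVec_mulVec]
  -- The fixed representative of the class is only equivalent to `τ`, so `B` is corrected by a
  -- unitary `U`.
  let σ : Dual G := Quotient.mk (Irrep.setoid G) ⟨_, τ, hirr⟩
  obtain ⟨U, hU1, -, hU⟩ : σ.rep.Equivalent τ := Quotient.mk_out (s := Irrep.setoid G) ⟨_, τ, hirr⟩
  refine ⟨σ, B * U, ?_, fun s => ?_, fun v => ?_⟩
  · rw [conjTranspose_mul, Matrix.mul_assoc, ← Matrix.mul_assoc Bᴴ, hB, Matrix.one_mul, hU1]
  · rw [← Matrix.mul_assoc, ← hτ, Matrix.mul_assoc, ← hU, Matrix.mul_assoc]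
  · rw [← Matrix.mulVec_mulVec]
    exact hqC (hBq _)

open Classical in
/-- Any orthogonal system of irreducible subrepresentations extends to a complete one. -/
theorem exists_complete_system (ρ : MatrixRep G κ) (n : ℕ) :
    ∀ T : Finset (Σ σ : Dual G, Matrix κ (Fin σ.dim) ℂ),
      (∀ x ∈ T, x.2ᴴ * x.2 = 1 ∧ ∀ s, ρ.mat s * x.2 = x.2 * x.1.rep.mat s) →
      (∀ x ∈ T, ∀ y ∈ T, x ≠ y → x.2ᴴ * y.2 = 0) →
      Module.finrank ℂ (⨅ x ∈ T, LinearMap.ker x.2ᴴ.mulVecLin : Submodule ℂ (κ → ℂ)) = n →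
    ∃ T : Finset (Σ σ : Dual G, Matrix κ (Fin σ.dim) ℂ),
      (∀ x ∈ T, x.2ᴴ * x.2 = 1 ∧ ∀ s, ρ.mat s * x.2 = x.2 * x.1.rep.mat s) ∧
      (∀ x ∈ T, ∀ y ∈ T, x ≠ y → x.2ᴴ * y.2 = 0) ∧
      ∀ v : κ → ℂ, (∀ x ∈ T, x.2ᴴ.mulVec v = 0) → v = 0 := by
  -- `n` is the dimension of the orthogonal complement of the ranges collected so far. This
  -- complement is invariant because adjoints of intertwiners intertwine; a new irreducible piece
  -- found inside it lowers `n`.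
  induction n using Nat.strong_induction_on with
  | _ n ih =>
  intro T h1 h2 hn
  set C : Submodule ℂ (κ → ℂ) := ⨅ x ∈ T, LinearMap.ker x.2ᴴ.mulVecLin with hCdef
  have hmem : ∀ v, v ∈ C ↔ ∀ x ∈ T, x.2ᴴ.mulVec v = 0 := fun v => by
    simp [hCdef, Submodule.mem_iInf]
  by_cases hC : C = ⊥
  · refine ⟨T, h1, h2, fun v hv => ?_⟩
    have : v ∈ C := (hmem v).2 hv
    rwa [hC, Submodule.mem_bot] at this
  obtain ⟨σ, B, hB, hint, hBC⟩ := exists_irrep_embedding ρ C hC fun s v hv => by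
    rw [hmem] at hv ⊢
    intro x hx
    have h3 := MatrixRep.intertwine_conjTranspose (ρ := x.1.rep) (τ := ρ)
      (fun s => ((h1 x hx).2 s).symm) s
    rw [Matrix.mulVec_mulVec, h3, ← Matrix.mulVec_mulVec, hv x hx, Matrix.mulVec_zero]
  have horth : ∀ x ∈ T, x.2ᴴ * B = 0 := fun x hx => by
    apply Matrix.toLin'.injective
    refine LinearMap.ext fun u => ?_
    rw [Matrix.toLin'_apply, ← Matrix.mulVec_mulVec, (hmem _).1 (hBC u) x hx]
    simp
  let T' := insert (⟨σ, B⟩ : Σ σ : Dual G, Matrix κ (Fin σ.dim) ℂ) T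
  refine ih _ ?_ T' ?_ ?_ rfl
  · rw [← hn]
    refine Submodule.finrank_lt_finrank_of_lt (lt_of_le_of_ne ?_ ?_)
    · rw [hCdef]
      simp only [T', Finset.iInf_insert]
      exact inf_le_right
    · intro heq
      have hall : ∀ u, B.mulVec u = 0 := fun u => by
        have h3 : B.mulVec u ∈ (⨅ x ∈ T', LinearMap.ker x.2ᴴ.mulVecLin) := heq ▸ hBC u
        simp only [T', Finset.iInf_insert] at h3
        have h4 : Bᴴ.mulVec (B.mulVec u) = 0 := h3.1
        rw [Matrix.mulVec_mulVec, hB, Matrix.one_mulVec] at h4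
        rw [h4, Matrix.mulVec_zero]
      have hB0 : B = 0 := by
        apply Matrix.toLin'.injective
        refine LinearMap.ext fun u => ?_
        rw [Matrix.toLin'_apply, hall]
        simp
      rw [hB0, Matrix.mul_zero] at hB
      have h5 := congrFun (congrFun hB ⟨0, σ.dim_pos⟩) ⟨0, σ.dim_pos⟩
      simp at h5
  · intro x hx
    rcases Finset.mem_insert.1 hx with rfl | hx
    · exact ⟨hB, hint⟩
    · exact h1 x hx
  · intro x hx y hy hxy
    rcases Finset.mem_insert.1 hx with rfl | hx <;> rcases Finset.mem_insert.1 hy with rfl | hy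
    · exact absurd rfl hxy
    · have := congrArg conjTranspose (horth y hy)
      simpa using this
    · exact horth x hx
    · exact h2 x hx y hy hxy

/-- **Complete reducibility.** -/
theorem exists_equivalent_directSum (ρ : MatrixRep G κ) :
    ∃ (n : ℕ) (τ : Fin n → Dual G), ρ.Equivalent (MatrixRep.directSum fun i => (τ i).rep) := by
  classical
  obtain ⟨T, h1, h2, h3⟩ := exists_complete_system ρ _ ∅ (by simp) (by simp) rfl
  let e := T.equivFin.symm
  let τ : Fin T.card → Dual G := fun i => (e i).1.1
  let B : ∀ i, Matrix κ (Fin (τ i).dim) ℂ := fun i => (e i).1.2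
  -- `U` stacks the matrices $B_i^*$: orthonormality of the system is $UU^*=1$, and completeness is
  -- injectivity of `U`.
  let U : Matrix (Σ i, Fin (τ i).dim) κ ℂ := fun x a => star (B x.1 a x.2)
  have hUU : U * Uᴴ = 1 := by
    ext ⟨i, c⟩ ⟨j, d⟩
    have h4 : (U * Uᴴ) ⟨i, c⟩ ⟨j, d⟩ = ((B i)ᴴ * B j) c d := by
      rw [Matrix.mul_apply, Matrix.mul_apply]
      refine Finset.sum_congr rfl fun a _ => ?_
      rw [Matrix.conjTranspose_apply U, Matrix.conjTranspose_apply]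
      simp only [U, star_star]
    rw [h4]
    by_cases hij : i = j
    · subst hij
      rw [(h1 _ (e i).2).1, Matrix.one_apply, Matrix.one_apply]
      simp
    · rw [h2 _ (e i).2 _ (e j).2 (fun h => hij (e.injective (Subtype.ext h)))]
      rw [Matrix.one_apply_ne]
      · rfl
      · intro h
        exact hij (congrArg Sigma.fst h)
  have hinj : ∀ v, U.mulVec v = 0 → v = 0 := fun v hv => by
    refine h3 v fun x hx => ?_
    obtain ⟨i, hi⟩ := e.surjective ⟨x, hx⟩
    have hx' : x = (e i).1 := by rw [hi]
    subst hx'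
    funext c
    exact congrFun hv ⟨i, c⟩
  -- $U(U^*U-1)=0$ and `U` is injective, so no dimension count is needed.
  have hUU' : Uᴴ * U = 1 := by
    apply Matrix.toLin'.injective
    refine LinearMap.ext fun v => ?_
    rw [← sub_eq_zero]
    refine hinj _ ?_
    rw [Matrix.mulVec_sub, Matrix.toLin'_apply, Matrix.toLin'_apply, Matrix.mulVec_mulVec,
      Matrix.mulVec_mulVec, ← Matrix.mul_assoc, hUU, Matrix.one_mul, Matrix.mul_one, sub_self]
  refine ⟨_, τ, U, hUU', hUU, fun s => ?_⟩
  ext ⟨i, c⟩ a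
  have h4 := MatrixRep.intertwine_conjTranspose (ρ := (τ i).rep) (τ := ρ) (X := B i)
    (fun s => ((h1 _ (e i).2).2 s).symm) s
  have h5 := congrFun (congrFun h4 c) a
  calc (U * ρ.mat s) ⟨i, c⟩ a = ((B i)ᴴ * ρ.mat s) c a := rfl
    _ = ((τ i).rep.mat s * (B i)ᴴ) c a := h5
    _ = (Matrix.blockDiagonal' (fun i => (τ i).rep.mat s) * U) ⟨i, c⟩ a := by
      rw [Matrix.mul_apply, Matrix.mul_apply, Fintype.sum_sigma, Finset.sum_eq_single i]
      · simp [U]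
      · intro j _ hji
        refine Finset.sum_eq_zero fun d _ => ?_
        rw [Matrix.blockDiagonal'_apply_ne _ _ _ (Ne.symm hji), zero_mul]
      · simp

end RepresentationTheory

/-! ### Summands of a Hilbert sum -/

noncomputable section BlockOperators

open scoped Classical in
/-- The embedding of a summand into a Hilbert sum. -/
def blockIncl {ι : Type*} (V : ι → Type*) [∀ i, NormedAddCommGroup (V i)]
    [∀ i, InnerProductSpace ℂ (V i)] (i : ι) : V i →L[ℂ] lp V 2 :=
  lp.singleContinuousLinearMap ℂ V 2 i

section
variable {ι : Type*} {V : ι → Type*} [∀ i, NormedAddCommGroup (V i)]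
  [∀ i, InnerProductSpace ℂ (V i)]

theorem blockIncl_apply_self (i : ι) (v : V i) : blockIncl V i v i = v := by
  classical
  simp [blockIncl]

theorem blockIncl_apply_ne {i j : ι} (h : j ≠ i) (v : V i) : blockIncl V i v j = 0 := by
  classical
  simp [blockIncl, h]

theorem inner_blockIncl_left (i : ι) (v : V i) (x : lp V 2) :
    ⟪blockIncl V i v, x⟫_ℂ = ⟪v, x i⟫_ℂ := by
  classical
  rw [blockIncl, lp.singleContinuousLinearMap_apply]
  convert! lp.inner_single_left (𝕜 := ℂ) i v x

theorem inner_blockIncl_right (i : ι) (v : V i) (x : lp V 2) :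
    ⟪x, blockIncl V i v⟫_ℂ = ⟪x i, v⟫_ℂ := by
  rw [← inner_conj_symm, inner_blockIncl_left, inner_conj_symm]

theorem hasSum_blockIncl (x : lp V 2) : HasSum (fun i => blockIncl V i (x i)) x := by
  classical
  have := lp.hasSum_single (E := V) (p := 2) (by simp) x
  convert! this

theorem blockIncl_ext {F : Type*} [NormedAddCommGroup F] [NormedSpace ℂ F] {A B : lp V 2 →L[ℂ] F}
    (h : ∀ i v, A (blockIncl V i v) = B (blockIncl V i v)) : A = B := by
  classical
  refine lp.ext_continuousLinearMap (by simp) fun i => ContinuousLinearMap.ext fun v => ?_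
  exact h i v

theorem sum_blockIncl_apply (F : Finset ι) (x : lp V 2) (j : ι) [Decidable (j ∈ F)] :
    (∑ i ∈ F, blockIncl V i (x i)) j = if j ∈ F then x j else 0 := by
  classical
  rw [lp.coeFn_sum, Finset.sum_apply]
  split_ifs with h
  · rw [Finset.sum_eq_single j, blockIncl_apply_self]
    · intro i _ hij
      exact blockIncl_apply_ne (Ne.symm hij) _
    · exact fun h' => absurd h h'
  · exact Finset.sum_eq_zero fun i hi => blockIncl_apply_ne (by rintro rfl; exact h hi) _

end

end BlockOperators

/-! ### Unitary representations and the bicommutant they generate -/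

section UnitaryOp

variable {H : Type u} [NormedAddCommGroup H] [InnerProductSpace ℂ H] {G : Type v} [Group G]

theorem unitaryOp_apply (lam : G →* (H ≃ₗᵢ[ℂ] H)) (s : G) (x : H) : unitaryOp lam s x = lam s x :=
  rfl

theorem unitaryOp_mul (lam : G →* (H ≃ₗᵢ[ℂ] H)) (s t : G) :
    unitaryOp lam (s * t) = unitaryOp lam s * unitaryOp lam t := by
  ext x
  rw [mul_apply_eq_comp, unitaryOp_apply, unitaryOp_apply, unitaryOp_apply, map_mul]
  rfl

theorem unitaryOp_one (lam : G →* (H ≃ₗᵢ[ℂ] H)) : unitaryOp lam 1 = 1 := by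
  ext x
  rw [unitaryOp_apply, map_one]
  rfl

end UnitaryOp

noncomputable section GeneratedVN

variable {H : Type u} [NormedAddCommGroup H] [InnerProductSpace ℂ H] [CompleteSpace H]

/-- `StarSubalgebra.centralizer` demands commutation with the adjoints as well. For a set closed
under adjoints these extra conditions are automatic, which leaves the plain bicommutant. -/
theorem mem_generatedVN_iff {S : Set (H →L[ℂ] H)} (hS : ∀ A ∈ S, star A ∈ S) {A : H →L[ℂ] H} :
    A ∈ (generatedVN S).toStarSubalgebra ↔ ∀ B : H →L[ℂ] H, (∀ C ∈ S, C * B = B * C) →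
      B * A = A * B := by
  change A ∈ StarSubalgebra.centralizer ℂ (StarSubalgebra.centralizer ℂ S : Set (H →L[ℂ] H)) ↔ _
  rw [StarSubalgebra.mem_centralizer_iff]
  constructor
  · intro h B hB
    refine (h B ?_).1
    rw [SetLike.mem_coe, StarSubalgebra.mem_centralizer_iff]
    exact fun C hC => ⟨hB C hC, hB _ (hS C hC)⟩
  · intro h B hB
    have hB' := star_mem hB
    rw [SetLike.mem_coe] at hB
    rw [StarSubalgebra.mem_centralizer_iff] at hB hB'
    exact ⟨h B fun C hC => (hB C hC).1, h _ fun C hC => (hB' C hC).1⟩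

variable {G : Type v} [Group G]

theorem star_unitaryOp (lam : G →* (H ≃ₗᵢ[ℂ] H)) (s : G) :
    star (unitaryOp lam s) = unitaryOp lam s⁻¹ := by
  rw [ContinuousLinearMap.star_eq_adjoint, eq_comm, ContinuousLinearMap.eq_adjoint_iff]
  intro x y
  rw [unitaryOp_apply, unitaryOp_apply, ← (lam s).inner_map_map]
  congr 1
  rw [map_inv]
  exact (lam s).apply_symm_apply x

theorem mem_VN_iff {lam : G →* (H ≃ₗᵢ[ℂ] H)} {A : H →L[ℂ] H} :
    A ∈ (VN lam).toStarSubalgebra ↔ ∀ B : H →L[ℂ] H,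
      (∀ s, unitaryOp lam s * B = B * unitaryOp lam s) → B * A = A * B := by
  rw [VN, mem_generatedVN_iff]
  · simp
  · rintro _ ⟨s, rfl⟩
    exact ⟨s⁻¹, (star_unitaryOp lam s).symm⟩

theorem mem_commutant_VN {lam : G →* (H ≃ₗᵢ[ℂ] H)} {B : H →L[ℂ] H}
    (h : ∀ s, unitaryOp lam s * B = B * unitaryOp lam s) : B ∈ (VN lam).commutant := by
  rw [VonNeumannAlgebra.mem_commutant_iff]
  exact fun A hA => ((mem_VN_iff.1 hA) B h).symm

end GeneratedVN

/-! ### Central diagonal operators on the regular representation -/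

noncomputable section DiagonalOperators

variable {G : Type u} [Group G] [TopologicalSpace G]

/-- The index set of the summands of `RegSpace G`. -/
abbrev DualIndex (G : Type u) [Group G] [TopologicalSpace G] : Type u := Σ π : Dual G, Fin π.dim

/-- The summands of `RegSpace G`. -/
abbrev RegBlock (i : DualIndex G) : Type := EuclideanSpace ℂ (Fin i.1.dim)

theorem regularRep_apply (s : G) (x : RegSpace G) (i : DualIndex G) :
    (unitaryOp (regularRep G) s x) i = i.1.rep.conj.isometries s (x i) := rfl

theorem regularRep_blockIncl (s : G) (i : DualIndex G) (v : RegBlock i) :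
    unitaryOp (regularRep G) s (blockIncl RegBlock i v) =
      blockIncl RegBlock i (i.1.rep.conj.isometries s v) := by
  ext j : 2
  rw [regularRep_apply]
  by_cases h : j = i
  · subst h
    rw [blockIncl_apply_self, blockIncl_apply_self]
  · rw [blockIncl_apply_ne h, blockIncl_apply_ne h, map_zero]

theorem conj_mat {κ : Type*} [Fintype κ] [DecidableEq κ] (ρ : MatrixRep G κ) (s : G) :
    ρ.conj.mat s = (ρ.mat s).map (starRingEnd ℂ) := rfl

/-- An intertwiner of the regular representation maps blocks to blocks of the same class. -/
theorem apply_blockIncl_eq_zero {B : RegSpace G →L[ℂ] RegSpace G}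
    (hB : ∀ s, unitaryOp (regularRep G) s * B = B * unitaryOp (regularRep G) s)
    {i j : DualIndex G} (hij : i.1 ≠ j.1) (v : RegBlock i) : B (blockIncl RegBlock i v) j = 0 := by
  let Φ : (Fin i.1.dim → ℂ) →ₗ[ℂ] (Fin j.1.dim → ℂ) :=
    (WithLp.linearEquiv 2 ℂ (Fin j.1.dim → ℂ)).toLinearMap ∘ₗ
      (lp.evalCLM ℂ RegBlock 2 j ∘L B ∘L blockIncl RegBlock i).toLinearMap ∘ₗ
        (WithLp.linearEquiv 2 ℂ (Fin i.1.dim → ℂ)).symm.toLinearMap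
  have hΦ : ∀ w : Fin i.1.dim → ℂ,
      Φ w = (B (blockIncl RegBlock i (WithLp.toLp 2 w)) j : RegBlock j).ofLp := fun w => rfl
  have hint : ∀ s w, Φ ((i.1.rep.conj.mat s).mulVec w) = (j.1.rep.conj.mat s).mulVec (Φ w) := by
    intro s w
    have h1 := congrArg (fun x : RegSpace G => (x j : RegBlock j).ofLp)
      (DFunLike.congr_fun (hB s) (blockIncl RegBlock i (WithLp.toLp 2 w)))
    simp only [mul_apply_eq_comp] at h1
    rw [regularRep_blockIncl, regularRep_apply, MatrixRep.isometries_apply,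
      MatrixRep.isometries_apply] at h1
    rw [hΦ, hΦ]
    exact h1.symm
  let X := LinearMap.toMatrix' Φ
  have hX : ∀ s, X * i.1.rep.conj.mat s = j.1.rep.conj.mat s * X := by
    intro s
    apply Matrix.toLin'.injective
    refine LinearMap.ext fun w => ?_
    rw [Matrix.toLin'_apply, Matrix.toLin'_apply, ← Matrix.mulVec_mulVec, ← Matrix.mulVec_mulVec,
      LinearMap.toMatrix'_mulVec, LinearMap.toMatrix'_mulVec, hint]
  -- The blocks carry the conjugate representations; the entrywise conjugate of $X$ intertwines the
  -- representatives themselves, to which Schur's lemma applies.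
  have hX0 : X.map (starRingEnd ℂ) = 0 := by
    by_contra hne
    refine hij (Dual.eq_of_intertwine (fun s => ?_) hne)
    have h1 := congrArg (fun M => M.map (starRingEnd ℂ)) (hX s)
    simp only [Matrix.map_mul, conj_mat, Matrix.map_map] at h1
    have h2 : (starRingEnd ℂ : ℂ → ℂ) ∘ (starRingEnd ℂ : ℂ → ℂ) = id := by
      funext z; simp
    rw [h2, Matrix.map_id, Matrix.map_id] at h1
    exact h1
  have hX1 : X = 0 := by
    ext a b
    have := congrFun (congrFun hX0 a) b
    simpa using this
  have h3 : Φ = 0 := LinearMap.toMatrix'.injective (by rw [map_zero]; exact hX1)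
  have h4 := hΦ v.ofLp
  rw [h3] at h4
  exact (WithLp.ofLp_injective 2 (h4.symm) :)

/-- The bound is $|K|$ because `lp.mapCLM` asks for a nonnegative constant, and a family of bounds
$|c_j|\le K$ yields $0\le K$ only when it is nonempty. -/
theorem norm_ofReal_smul_id_le {E : Type*} [NormedAddCommGroup E] [NormedSpace ℂ E] {c K : ℝ}
    (h : |c| ≤ K) : ‖(c : ℂ) • ContinuousLinearMap.id ℂ E‖ ≤ |K| := by
  refine ContinuousLinearMap.opNorm_le_bound _ (abs_nonneg K) fun x => ?_
  rw [smul_apply, norm_smul, Complex.norm_real]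
  exact mul_le_mul_of_nonneg_right (h.trans (le_abs_self K)) (norm_nonneg x)

/-- Multiplication of the blocks of `π` by the bounded scalars `f π`. -/
def diagOp (f : Dual G → ℝ) {K : ℝ} (hf : ∀ π, |f π| ≤ K) : RegSpace G →L[ℂ] RegSpace G :=
  lp.mapCLM (E := RegBlock) (F := RegBlock) 2
    (fun i => (f i.1 : ℂ) • ContinuousLinearMap.id ℂ (RegBlock i)) (abs_nonneg K)
    fun i => norm_ofReal_smul_id_le (hf i.1)

theorem diagOp_apply (f : Dual G → ℝ) {K : ℝ} (hf : ∀ π, |f π| ≤ K) (x : RegSpace G)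
    (i : DualIndex G) : diagOp f hf x i = (f i.1 : ℂ) • x i := rfl

theorem diagOp_blockIncl (f : Dual G → ℝ) {K : ℝ} (hf : ∀ π, |f π| ≤ K) (i : DualIndex G)
    (v : RegBlock i) : diagOp f hf (blockIncl RegBlock i v) =
      (f i.1 : ℂ) • blockIncl RegBlock i v := by
  ext j : 2
  rw [diagOp_apply, lp.coeFn_smul, Pi.smul_apply]
  by_cases h : j = i
  · subst h; rfl
  · rw [blockIncl_apply_ne h, smul_zero, smul_zero]

/-- By Schur's lemma an intertwiner only connects blocks of the same class, and there the diagonal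
operator is one and the same scalar. This puts it into the bicommutant. -/
theorem diagOp_comm {f : Dual G → ℝ} {K : ℝ} (hf : ∀ π, |f π| ≤ K)
    {B : RegSpace G →L[ℂ] RegSpace G}
    (hB : ∀ s, unitaryOp (regularRep G) s * B = B * unitaryOp (regularRep G) s) :
    B * diagOp f hf = diagOp f hf * B := by
  refine blockIncl_ext fun i v => ?_
  rw [mul_apply_eq_comp, mul_apply_eq_comp, diagOp_blockIncl, map_smul]
  ext j : 2
  rw [lp.coeFn_smul, Pi.smul_apply, diagOp_apply]
  by_cases h : i.1 = j.1
  · exact congrArg (fun π => (f π : ℂ) • B (blockIncl RegBlock i v) j) h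
  · rw [apply_blockIncl_eq_zero hB h, smul_zero, smul_zero]

theorem diagOp_mem_VN (f : Dual G → ℝ) {K : ℝ} (hf : ∀ π, |f π| ≤ K) :
    diagOp f hf ∈ (VN (regularRep G)).toStarSubalgebra :=
  mem_VN_iff.2 fun _ hB => diagOp_comm hf hB

theorem diagOp_mem_commutant (f : Dual G → ℝ) {K : ℝ} (hf : ∀ π, |f π| ≤ K) :
    diagOp f hf ∈ (VN (regularRep G)).commutant := by
  refine mem_commutant_VN fun s => ?_
  ext x i : 3
  rw [mul_apply_eq_comp, mul_apply_eq_comp, regularRep_apply, diagOp_apply,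
    diagOp_apply, map_smul, regularRep_apply]

theorem diagOp_mul (f g h : Dual G → ℝ) {K K' K'' : ℝ} (hf : ∀ π, |f π| ≤ K) (hg : ∀ π, |g π| ≤ K')
    (hh : ∀ π, |h π| ≤ K'') (hfg : ∀ π, f π * g π = h π) :
    diagOp f hf * diagOp g hg = diagOp h hh := by
  ext x i : 3
  rw [mul_apply_eq_comp, diagOp_apply, diagOp_apply, diagOp_apply, smul_smul, ← hfg]
  push_cast
  rfl

theorem diagOp_inner (f : Dual G → ℝ) {K : ℝ} (hf : ∀ π, |f π| ≤ K) (x y : RegSpace G) :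
    ⟪diagOp f hf x, y⟫_ℂ = ⟪x, diagOp f hf y⟫_ℂ := by
  rw [lp.inner_eq_tsum, lp.inner_eq_tsum]
  refine tsum_congr fun i => ?_
  rw [diagOp_apply, diagOp_apply, inner_smul_left, inner_smul_right, Complex.conj_ofReal]

theorem isSelfAdjoint_diagOp (f : Dual G → ℝ) {K : ℝ} (hf : ∀ π, |f π| ≤ K) :
    IsSelfAdjoint (diagOp f hf) := by
  rw [ContinuousLinearMap.isSelfAdjoint_iff_isSymmetric]
  exact diagOp_inner f hf

end DiagonalOperators

/-! ### The unbounded operator $W=\bigoplus\omega(\pi)1$ -/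

noncomputable section CentralOperator

variable {G : Type u} [Group G] [TopologicalSpace G] (ω : Dual G → ℝ)

/-- The graph of the maximal operator that multiplies the blocks of `π` by `ω π`. -/
def centralGraph : Submodule ℂ (RegSpace G × RegSpace G) where
  carrier := {p | ∀ i : DualIndex G, p.2 i = (ω i.1 : ℂ) • p.1 i}
  zero_mem' := by intro i; simp
  add_mem' := by
    intro a b ha hb i
    rw [Prod.snd_add, Prod.fst_add, lp.coeFn_add, lp.coeFn_add, Pi.add_apply, Pi.add_apply, ha, hb,
      smul_add]
  smul_mem' := by
    intro c a ha i
    rw [Prod.smul_snd, Prod.smul_fst, lp.coeFn_smul, lp.coeFn_smul, Pi.smul_apply, Pi.smul_apply,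
      ha, smul_comm]

theorem isClosed_centralGraph : IsClosed (centralGraph ω : Set (RegSpace G × RegSpace G)) := by
  have : (centralGraph ω : Set (RegSpace G × RegSpace G)) =
      ⋂ i : DualIndex G, {p | p.2 i = (ω i.1 : ℂ) • p.1 i} := by
    ext p
    rw [Set.mem_iInter]
    rfl
  rw [this]
  have hc (i : DualIndex G) : Continuous fun x : RegSpace G => x i :=
    (lp.evalCLM ℂ RegBlock 2 i).continuous
  exact isClosed_iInter fun i =>
    isClosed_eq ((hc i).comp continuous_snd) (((hc i).comp continuous_fst).const_smul (ω i.1 : ℂ))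

theorem centralGraph_toLinearPMap_graph :
    (centralGraph ω).toLinearPMap.graph = centralGraph ω := by
  refine Submodule.toLinearPMap_graph_eq _ fun p hp h0 => ?_
  ext i : 2
  rw [hp, h0]
  simp

/-- The partial sums of $(x,y)$ over finitely many blocks lie in the graph of the core and converge
to $(x,y)$. The closure of the core is therefore the maximal multiplication operator, and later
questions about $W$ become componentwise. -/
theorem centralCore_graph_topologicalClosure :
    (centralCore ω).graph.topologicalClosure = centralGraph ω := by
  refine le_antisymm (Submodule.topologicalClosure_minimal _ ?_ (isClosed_centralGraph ω)) ?_
  · rintro ⟨x, y⟩ hxy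
    rw [LinearPMap.mem_graph_iff] at hxy
    obtain ⟨z, rfl, rfl⟩ := hxy
    exact fun i => rfl
  · classical
    rintro ⟨x, y⟩ hxy
    have hx := hasSum_blockIncl x
    have hy := hasSum_blockIncl y
    refine mem_closure_of_tendsto (Filter.Tendsto.prodMk_nhds hx hy) (Filter.Eventually.of_forall
      fun F => ?_)
    change _ ∈ (centralCore ω).graph
    rw [LinearPMap.mem_graph_iff]
    refine ⟨⟨∑ i ∈ F, blockIncl RegBlock i (x i), F.finite_toSet.subset fun i hi => ?_⟩, rfl, ?_⟩
    · by_contra hF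
      refine hi ?_
      rw [sum_blockIncl_apply]
      exact if_neg fun h => hF h
    · ext i : 2
      refine Eq.trans (b := (ω i.1 : ℂ) • (∑ i ∈ F, blockIncl RegBlock i (x i)) i) rfl ?_
      rw [sum_blockIncl_apply, sum_blockIncl_apply]
      split_ifs
      · exact (hxy i).symm
      · rw [smul_zero]

theorem centralOperator_graph : (centralOperator ω).graph = centralGraph ω := by
  have hc : (centralCore ω).IsClosable := ⟨(centralGraph ω).toLinearPMap, by
    rw [centralCore_graph_topologicalClosure, centralGraph_toLinearPMap_graph]⟩
  rw [centralOperator, ← hc.graph_closure_eq_closure_graph, centralCore_graph_topologicalClosure]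

theorem mem_centralOperator_graph {x y : RegSpace G} :
    (x, y) ∈ (centralOperator ω).graph ↔ ∀ i : DualIndex G, y i = (ω i.1 : ℂ) • x i := by
  rw [centralOperator_graph]
  rfl

theorem centralOperator_isClosed : (centralOperator ω).IsClosed := by
  rw [LinearPMap.IsClosed, centralOperator_graph]
  exact isClosed_centralGraph ω

theorem blockIncl_mem_graph (i : DualIndex G) (v : RegBlock i) :
    (blockIncl RegBlock i v, (ω i.1 : ℂ) • blockIncl RegBlock i v) ∈ (centralOperator ω).graph := by
  rw [mem_centralOperator_graph]
  intro j
  rw [lp.coeFn_smul, Pi.smul_apply]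
  by_cases h : j = i
  · subst h; rfl
  · rw [blockIncl_apply_ne h, smul_zero, smul_zero]

theorem centralOperator_dense_domain : Dense ((centralOperator ω).domain : Set (RegSpace G)) := by
  intro x
  refine mem_closure_of_tendsto (hasSum_blockIncl x) (Filter.Eventually.of_forall fun F => ?_)
  exact Submodule.sum_mem _ fun i _ => LinearPMap.mem_domain_of_mem_graph (blockIncl_mem_graph ω i _)

/-- Testing the adjoint relation on vectors supported in one block gives exactly the componentwise
equation that describes the graph, since $\omega$ is real. -/
theorem centralOperator_isSelfAdjoint : IsSelfAdjoint (centralOperator ω) := by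
  rw [LinearPMap.isSelfAdjoint_def]
  refine LinearPMap.eq_of_eq_graph ?_
  rw [LinearPMap.adjoint_graph_eq_graph_adjoint (centralOperator_dense_domain ω)]
  ext ⟨x, y⟩
  rw [Submodule.mem_adjoint_iff, mem_centralOperator_graph]
  constructor
  · intro h i
    refine ext_inner_left ℂ fun v => ?_
    have h1 := h _ _ (blockIncl_mem_graph ω i v)
    rw [inner_smul_left, inner_blockIncl_left, inner_blockIncl_left, Complex.conj_ofReal,
      sub_eq_zero] at h1
    rw [inner_smul_right]
    exact h1.symm
  · intro h a b hab
    rw [mem_centralOperator_graph] at hab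
    rw [sub_eq_zero, lp.inner_eq_tsum, lp.inner_eq_tsum]
    refine tsum_congr fun i => ?_
    change ⟪b i, x i⟫_ℂ = ⟪a i, y i⟫_ℂ
    rw [h, hab, inner_smul_left, inner_smul_right, Complex.conj_ofReal]

theorem centralOperator_isPositive (hω : ∀ π, 0 ≤ ω π) :
    IsPositiveOperator (centralOperator ω) := by
  refine ⟨centralOperator_isSelfAdjoint ω, fun x => ?_⟩
  have h := (mem_centralOperator_graph ω).1 (LinearPMap.mem_graph _ x)
  have hs := lp.hasSum_inner (𝕜 := ℂ) (centralOperator ω x) (x : RegSpace G)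
  refine (Complex.hasSum_re hs).nonneg fun i => ?_
  rw [h, inner_smul_left, Complex.conj_ofReal, Complex.re_ofReal_mul]
  exact mul_nonneg (hω _) (inner_self_nonneg (𝕜 := ℂ))

variable {ω} {δ : ℝ}

theorem abs_inv_le (hδ : 0 < δ) (hω : ∀ π, δ < ω π) (π : Dual G) : |(ω π)⁻¹| ≤ δ⁻¹ := by
  rw [abs_of_pos (inv_pos.2 (hδ.trans (hω π)))]
  exact inv_anti₀ hδ (hω π).le

theorem isBoundedInverse_diagOp (hδ : 0 < δ) (hω : ∀ π, δ < ω π) :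
    IsBoundedInverse (centralOperator ω) (diagOp (fun π => (ω π)⁻¹) (abs_inv_le hδ hω)) := by
  have h0 : ∀ π, (ω π : ℂ) ≠ 0 := fun π => by exact_mod_cast (hδ.trans (hω π)).ne'
  constructor
  · intro x
    rw [mem_centralOperator_graph]
    intro i
    rw [diagOp_apply, smul_smul, Complex.ofReal_inv, mul_inv_cancel₀ (h0 _), one_smul]
  · intro x y hxy
    rw [mem_centralOperator_graph] at hxy
    ext i : 2
    rw [diagOp_apply, hxy, smul_smul, Complex.ofReal_inv, inv_mul_cancel₀ (h0 _), one_smul]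

/-- The graph of $W$ consists of the pairs $(Sy,y)$ with $S=W^{-1}\in VN(G)$, and $S$ commutes with
the unitaries of the commutant. -/
theorem isAffiliated_centralOperator (hδ : 0 < δ) (hω : ∀ π, δ < ω π) :
    IsAffiliated (VN (regularRep G)) (centralOperator ω) := by
  intro U hU hUc x y
  obtain ⟨h1, h2⟩ := isBoundedInverse_diagOp hδ hω
  have hcomm := VonNeumannAlgebra.mem_commutant_iff.1 hUc _
    (diagOp_mem_VN (fun π => (ω π)⁻¹) (abs_inv_le hδ hω))
  set S := diagOp (fun π => (ω π)⁻¹) (abs_inv_le hδ hω)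
  have hc : ∀ z, S (U z) = U (S z) := fun z => DFunLike.congr_fun hcomm z
  constructor
  · intro h
    have h3 := h2 _ _ h
    rw [hc] at h3
    have h4 : S y = x := by
      have h5 := congrArg (fun z => (star U : RegSpace G →L[ℂ] RegSpace G) z) h3
      have h6 : ∀ z, (star U : RegSpace G →L[ℂ] RegSpace G) (U z) = z := fun z =>
        DFunLike.congr_fun (Unitary.star_mul_self_of_mem hU) z
      simpa only [h6] using h5
    rw [← h4]
    exact h1 y
  · intro h
    rw [← h2 _ _ h, ← hc]
    exact h1 _

end CentralOperator

/-! ### The ultraweak topology and von Neumann's density theorem -/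

noncomputable section Ultraweak

open Filter Topology

section SquareSummable

variable {ι : Type*} {V : ι → Type*} [∀ i, NormedAddCommGroup (V i)]

theorem memℓp_two_iff {f : ∀ i, V i} : Memℓp f 2 ↔ Summable fun i => ‖f i‖ ^ 2 := by
  rw [memℓp_gen_iff (by simp)]
  simp

theorem lp_two_summable (f : lp V 2) : Summable fun i => ‖f i‖ ^ 2 :=
  memℓp_two_iff.1 (lp.memℓp f)

theorem lp_two_norm_sq (f : lp V 2) : ‖f‖ ^ 2 = ∑' i, ‖f i‖ ^ 2 := by
  have := lp.norm_rpow_eq_tsum (p := 2) (by simp) f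
  simpa using this

theorem summable_mul_norm {x y : ι → ℝ} (hx : Summable fun n => x n ^ 2)
    (hy : Summable fun n => y n ^ 2) : Summable fun n => |x n| * |y n| := by
  refine Summable.of_nonneg_of_le (fun n => mul_nonneg (abs_nonneg _) (abs_nonneg _)) (fun n => ?_)
    (hx.add hy)
  nlinarith [sq_nonneg (|x n| - |y n|), sq_abs (x n), sq_abs (y n), sq_nonneg (x n),
    sq_nonneg (y n)]

end SquareSummable

section Amplification

variable {H : Type u} [NormedAddCommGroup H] [InnerProductSpace ℂ H]

/-- The amplification `⨁ A` of `A` to a Hilbert sum of copies of `H`. -/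
def ampl (J : Type*) (A : H →L[ℂ] H) : lp (fun _ : J => H) 2 →L[ℂ] lp (fun _ : J => H) 2 :=
  lp.mapCLM 2 (fun _ => A) (norm_nonneg A) fun _ => le_rfl

theorem ampl_apply {J : Type*} (A : H →L[ℂ] H) (x : lp (fun _ : J => H) 2) (j : J) :
    ampl J A x j = A (x j) := rfl

theorem ampl_blockIncl {J : Type*} (A : H →L[ℂ] H) (j : J) (v : H) :
    ampl J A (blockIncl (fun _ => H) j v) = blockIncl (fun _ => H) j (A v) := by
  ext k : 2
  rw [ampl_apply]
  by_cases h : k = j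
  · subst h
    rw [blockIncl_apply_self, blockIncl_apply_self]
  · rw [blockIncl_apply_ne h, blockIncl_apply_ne h, map_zero]

/-- The vectors `(⨁ B) x` with `B` in the span of `lam s`. -/
def orbitSpan {G : Type v} [Group G] (lam : G →* (H ≃ₗᵢ[ℂ] H)) {J : Type*}
    (x : lp (fun _ : J => H) 2) : Submodule ℂ (lp (fun _ : J => H) 2) :=
  Submodule.span ℂ (Set.range fun s => ampl J (unitaryOp lam s) x)

theorem exists_span_of_mem_orbitSpan {G : Type v} [Group G] (lam : G →* (H ≃ₗᵢ[ℂ] H)) {J : Type*}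
    (x : lp (fun _ : J => H) 2) {y : lp (fun _ : J => H) 2} (hy : y ∈ orbitSpan lam x) :
    ∃ B ∈ Submodule.span ℂ (Set.range (unitaryOp lam)), ampl J B x = y := by
  induction hy using Submodule.span_induction with
  | mem z hz =>
    obtain ⟨s, rfl⟩ := hz
    exact ⟨_, Submodule.subset_span ⟨s, rfl⟩, rfl⟩
  | zero =>
    refine ⟨0, Submodule.zero_mem _, ?_⟩
    ext j : 2
    rw [ampl_apply]
    rfl
  | add z w _ _ hz hw =>
    obtain ⟨B, hB, rfl⟩ := hz
    obtain ⟨C, hC, rfl⟩ := hw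
    refine ⟨B + C, Submodule.add_mem _ hB hC, ?_⟩
    ext j : 2
    rw [ampl_apply]
    rfl
  | smul c z _ hz =>
    obtain ⟨B, hB, rfl⟩ := hz
    refine ⟨c • B, Submodule.smul_mem _ c hB, ?_⟩
    ext j : 2
    rw [ampl_apply]
    rfl

end Amplification

variable {H : Type u} [NormedAddCommGroup H] [InnerProductSpace ℂ H] [CompleteSpace H]

/-- **Von Neumann's density theorem**: an operator in the bicommutant maps `x` into the closure of
the orbit of `x`, also after amplification. -/
theorem ampl_mem_closure_orbitSpan {G : Type v} [Group G] (lam : G →* (H ≃ₗᵢ[ℂ] H)) {J : Type*}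
    (x : lp (fun _ : J => H) 2) {A : H →L[ℂ] H} (hA : A ∈ (VN lam).toStarSubalgebra) :
    ampl J A x ∈ (orbitSpan lam x).topologicalClosure := by
  set M := (orbitSpan lam x).topologicalClosure with hM
  have : CompleteSpace M := (Submodule.isClosed_topologicalClosure _).completeSpace_coe
  have hxM : x ∈ M := by
    refine Submodule.le_topologicalClosure _ (Submodule.subset_span ⟨1, ?_⟩)
    ext j : 2
    simp only [ampl_apply, unitaryOp_one]
    rfl
  have hinv : ∀ s, ∀ y ∈ M, ampl J (unitaryOp lam s) y ∈ M := by
    intro s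
    have h1 : orbitSpan lam x ≤ M.comap (ampl J (unitaryOp lam s)).toLinearMap := by
      rw [orbitSpan, Submodule.span_le]
      rintro _ ⟨t, rfl⟩
      refine Submodule.le_topologicalClosure _ (Submodule.subset_span ⟨s * t, ?_⟩)
      ext j : 2
      simp only [ampl_apply, unitaryOp_mul, ContinuousLinearMap.coe_coe]
      rfl
    exact Submodule.topologicalClosure_minimal _ h1
      ((Submodule.isClosed_topologicalClosure _).preimage (ampl J (unitaryOp lam s)).continuous)
  have hadj : ∀ s (y z : lp (fun _ : J => H) 2), ⟪ampl J (unitaryOp lam s) y, z⟫_ℂ =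
      ⟪y, ampl J (unitaryOp lam s⁻¹) z⟫_ℂ := by
    intro s y z
    rw [lp.inner_eq_tsum, lp.inner_eq_tsum]
    refine tsum_congr fun j => ?_
    rw [ampl_apply, ampl_apply, ← star_unitaryOp, ContinuousLinearMap.star_eq_adjoint,
      ContinuousLinearMap.adjoint_inner_right]
  set P := M.starProjection with hP
  -- `M` is invariant under the amplifications of both $\lambda(s)$ and
  -- $\lambda(s^{-1})=\lambda(s)^*$, so the projection onto it commutes with them.
  have hcomm : ∀ s y, P (ampl J (unitaryOp lam s) y) = ampl J (unitaryOp lam s) (P y) := by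
    intro s y
    refine Submodule.eq_starProjection_of_mem_of_inner_eq_zero
      (hinv s _ (Submodule.starProjection_apply_mem _ _)) fun w hw => ?_
    rw [← map_sub, hadj]
    exact Submodule.starProjection_inner_eq_zero _ _ (hinv _ _ hw)
  -- The matrix entries of `P` with respect to the copies of $H$ lie in the commutant of $\lambda$,
  -- hence commute with `A`. So `P` commutes with the amplification of `A`.
  have hPA : ∀ k v, P (ampl J A (blockIncl (fun _ => H) k v)) =
      ampl J A (P (blockIncl (fun _ => H) k v)) := by
    intro k v
    ext j : 2
    let B : H →L[ℂ] H := lp.evalCLM ℂ (fun _ : J => H) 2 j ∘L P ∘L blockIncl (fun _ => H) k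
    have hB : ∀ s, unitaryOp lam s * B = B * unitaryOp lam s := by
      intro s
      ext z
      have h2 := hcomm s (blockIncl (fun _ => H) k z)
      rw [ampl_blockIncl] at h2
      exact (congrArg (fun y : lp (fun _ : J => H) 2 => y j) h2).symm
    have h3 := DFunLike.congr_fun (mem_VN_iff.1 hA B hB) v
    rw [ampl_blockIncl, ampl_apply]
    exact h3
  have hPA' : P ∘L ampl J A = ampl J A ∘L P := blockIncl_ext hPA
  have hx : P x = x := Submodule.starProjection_eq_self_iff.2 hxM
  have h4 := DFunLike.congr_fun hPA' x
  rw [ContinuousLinearMap.comp_apply, ContinuousLinearMap.comp_apply, hx] at h4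
  rw [← h4]
  exact Submodule.starProjection_apply_mem _ _

/-- The index set of the functionals that define the ultraweak topology. -/
abbrev UltraweakIndex (H : Type u) [NormedAddCommGroup H] : Type u :=
  {p : (ℕ → H) × (ℕ → H) // (Summable fun n => ‖p.1 n‖ ^ 2) ∧ (Summable fun n => ‖p.2 n‖ ^ 2)}

theorem nhds_weakStar (M : VonNeumannAlgebra H) (A : M.toStarSubalgebra) :
    @nhds _ (weakStarTopology M) A = ⨅ p : UltraweakIndex H,
      comap (fun B : M.toStarSubalgebra => ∑' n, ⟪p.1.1 n, (B : H →L[ℂ] H) (p.1.2 n)⟫_ℂ)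
        (𝓝 (∑' n, ⟪p.1.1 n, (A : H →L[ℂ] H) (p.1.2 n)⟫_ℂ)) := by
  rw [weakStarTopology, ultraweakTopology, induced_iInf, nhds_iInf]
  refine iInf_congr fun p => ?_
  rw [induced_compose, nhds_induced]
  rfl

theorem tendsto_weakStar_iff {M : VonNeumannAlgebra H} {ι : Type*} {l : Filter ι}
    {A : ι → M.toStarSubalgebra} {A₀ : M.toStarSubalgebra} :
    Tendsto A l (@nhds _ (weakStarTopology M) A₀) ↔ ∀ p : UltraweakIndex H,
      Tendsto (fun i => ∑' n, ⟪p.1.1 n, (A i : H →L[ℂ] H) (p.1.2 n)⟫_ℂ) l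
        (𝓝 (∑' n, ⟪p.1.1 n, (A₀ : H →L[ℂ] H) (p.1.2 n)⟫_ℂ)) := by
  rw [nhds_weakStar, tendsto_iInf]
  exact forall_congr' fun p => tendsto_comap_iff

theorem continuous_weakStar_functional (M : VonNeumannAlgebra H) (p : UltraweakIndex H) :
    @Continuous _ _ (weakStarTopology M) _
      fun A : M.toStarSubalgebra => ∑' n, ⟪p.1.1 n, (A : H →L[ℂ] H) (p.1.2 n)⟫_ℂ := by
  let := weakStarTopology M
  rw [continuous_iff_continuousAt]
  exact fun A => tendsto_weakStar_iff.1 tendsto_id p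

theorem continuous_to_weakStar {X : Type*} [TopologicalSpace X] {M : VonNeumannAlgebra H}
    {f : X → M.toStarSubalgebra}
    (h : ∀ p : UltraweakIndex H,
      Continuous fun x => ∑' n, ⟪p.1.1 n, (f x : H →L[ℂ] H) (p.1.2 n)⟫_ℂ) :
    @Continuous _ _ _ (weakStarTopology M) f := by
  let := weakStarTopology M
  rw [continuous_iff_continuousAt]
  exact fun x => tendsto_weakStar_iff.2 fun p => (h p).tendsto x

/-- Bounded nets that converge strongly converge in the w*-topology. -/
theorem tendsto_weakStar_of_strong {M : VonNeumannAlgebra H} {ι : Type*} {l : Filter ι}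
    {A : ι → M.toStarSubalgebra} {A₀ : M.toStarSubalgebra} {C : ℝ}
    (hC : ∀ i, ‖(A i : H →L[ℂ] H)‖ ≤ C)
    (h : ∀ x, Tendsto (fun i => (A i : H →L[ℂ] H) x) l (𝓝 ((A₀ : H →L[ℂ] H) x))) :
    Tendsto A l (@nhds _ (weakStarTopology M) A₀) := by
  rw [tendsto_weakStar_iff]
  intro p
  refine tendsto_tsum_of_dominated_convergence
    ((summable_mul_norm p.2.1 p.2.2).mul_left C) (fun n => ?_) (Eventually.of_forall fun i n => ?_)
  · exact tendsto_const_nhds.inner (h _)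
  · refine (norm_inner_le_norm _ _).trans ?_
    rw [abs_norm, abs_norm]
    calc _ ≤ ‖p.1.1 n‖ * (C * ‖p.1.2 n‖) := by
          gcongr
          exact (A i : H →L[ℂ] H).le_of_opNorm_le (hC i) _
      _ = C * (‖p.1.1 n‖ * ‖p.1.2 n‖) := by ring

/-- The topology is defined by sequences, but the decomposition of $H\otimes_2H$ may have an
uncountable index set. A square-summable family has countable support, so the support of `a` is
injected into ℕ and both families are extended by zero; outside that support all terms vanish. -/
theorem continuous_weakStar_tsum (M : VonNeumannAlgebra H) {J : Type*} {a b : J → H}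
    (ha : Summable fun j => ‖a j‖ ^ 2) (hb : Summable fun j => ‖b j‖ ^ 2) :
    @Continuous _ _ (weakStarTopology M) _
      fun A : M.toStarSubalgebra => ∑' j, ⟪a j, (A : H →L[ℂ] H) (b j)⟫_ℂ := by
  let S : Set J := Function.support fun j => ‖a j‖ ^ 2
  have hS : Countable S := ha.countable_support
  obtain ⟨e, he⟩ := hS
  have ha' : Summable fun j : S => ‖a j‖ ^ 2 := ha.subtype S
  have hb' : Summable fun j : S => ‖b j‖ ^ 2 := hb.subtype S
  let x : ℕ → H := Function.extend e (fun j : S => a j) 0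
  let y : ℕ → H := Function.extend e (fun j : S => b j) 0
  have hx : Summable fun n => ‖x n‖ ^ 2 := by
    refine ((summable_extend_zero he).2 ha').congr fun n => ?_
    by_cases hn : ∃ j, e j = n
    · obtain ⟨j, rfl⟩ := hn
      simp only [x, he.extend_apply]
    · simp [x, Function.extend_apply' _ _ _ hn]
  have hy : Summable fun n => ‖y n‖ ^ 2 := by
    refine ((summable_extend_zero he).2 hb').congr fun n => ?_
    by_cases hn : ∃ j, e j = n
    · obtain ⟨j, rfl⟩ := hn
      simp only [y, he.extend_apply]
    · simp [y, Function.extend_apply' _ _ _ hn]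
  convert! continuous_weakStar_functional M ⟨(x, y), hx, hy⟩ using 2 with A
  have h1 : (fun n => ⟪x n, (A : H →L[ℂ] H) (y n)⟫_ℂ) =
      Function.extend e (fun j : S => ⟪a j, (A : H →L[ℂ] H) (b j)⟫_ℂ) 0 := by
    funext n
    by_cases hn : ∃ j, e j = n
    · obtain ⟨j, rfl⟩ := hn
      simp only [x, y, he.extend_apply]
    · simp [x, Function.extend_apply' _ _ _ hn]
  change _ = ∑' n, ⟪x n, (A : H →L[ℂ] H) (y n)⟫_ℂ
  rw [h1, tsum_extend_zero he]
  refine (tsum_subtype_eq_of_support_subset (f := fun j => ⟪a j, (A : H →L[ℂ] H) (b j)⟫_ℂ)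
    fun j hj => ?_).symm
  simp only [Function.mem_support, ne_eq] at hj
  simp only [S, Function.mem_support, ne_eq]
  intro h0
  apply hj
  rw [pow_eq_zero_iff two_ne_zero, norm_eq_zero] at h0
  rw [h0, inner_zero_left]

theorem continuous_weakStar_inner (M : VonNeumannAlgebra H) (a b : H) :
    @Continuous _ _ (weakStarTopology M) _
      fun A : M.toStarSubalgebra => ⟪a, (A : H →L[ℂ] H) b⟫_ℂ := by
  have := continuous_weakStar_tsum M (J := Unit) (a := fun _ => a) (b := fun _ => b)
    (Summable.of_finite) (Summable.of_finite)
  simpa using this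

/-- The span of the `lam s` is w*-dense in `VN lam`. -/
theorem dense_span_unitaryOp {G : Type v} [Group G] (lam : G →* (H ≃ₗᵢ[ℂ] H)) :
    @Dense _ (weakStarTopology (VN lam)) {A : (VN lam).toStarSubalgebra |
      (A : H →L[ℂ] H) ∈ Submodule.span ℂ (Set.range (unitaryOp lam))} := by
  classical
  intro A
  have hle : Submodule.span ℂ (Set.range (unitaryOp lam)) ≤
      Subalgebra.toSubmodule (VN lam).toStarSubalgebra.toSubalgebra := by
    rw [Submodule.span_le]
    rintro _ ⟨s, rfl⟩
    exact subset_generatedVN _ ⟨s, rfl⟩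
  -- The approximating net is indexed by a finite set of functionals and a precision $1/(N+1)$.
  have key : ∀ i : Finset (UltraweakIndex H) × ℕ, ∃ B : (VN lam).toStarSubalgebra,
      (B : H →L[ℂ] H) ∈ Submodule.span ℂ (Set.range (unitaryOp lam)) ∧ ∀ p ∈ i.1,
        ‖∑' n, ⟪p.1.1 n, (B : H →L[ℂ] H) (p.1.2 n)⟫_ℂ -
          ∑' n, ⟪p.1.1 n, (A : H →L[ℂ] H) (p.1.2 n)⟫_ℂ‖ ≤
            Real.sqrt (∑' n, ‖p.1.1 n‖ ^ 2) * (1 / (i.2 + 1)) := by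
    rintro ⟨F, N⟩
    -- All second sequences of the functionals in `F` are stacked into a single square-summable
    -- vector. One element `B` of the span that is close to `A` on this vector serves all of `F`, by
    -- the Cauchy–Schwarz inequality.
    let x : lp (fun _ : F × ℕ => H) 2 := ⟨fun q => q.1.1.1.2 q.2, by
      refine memℓp_two_iff.2 ?_
      rw [summable_prod_of_nonneg fun _ => sq_nonneg _]
      exact ⟨fun q => q.1.2.2, Summable.of_finite⟩⟩
    have hmem := ampl_mem_closure_orbitSpan lam x A.2
    obtain ⟨y, hy, hyd⟩ := Metric.mem_closure_iff.1 hmem (1 / (N + 1)) Nat.one_div_pos_of_nat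
    obtain ⟨B, hB, rfl⟩ := exists_span_of_mem_orbitSpan lam x hy
    refine ⟨⟨B, hle hB⟩, hB, fun p hp => ?_⟩
    let a : lp (fun _ : ℕ => H) 2 := ⟨p.1.1, memℓp_two_iff.2 p.2.1⟩
    let d : lp (fun _ : ℕ => H) 2 := ⟨fun n => (ampl _ B x - ampl _ A x : lp _ 2) (⟨p, hp⟩, n),
      memℓp_two_iff.2 ((lp_two_summable (ampl _ B x - ampl _ A x)).comp_injective
        (Prod.mk_right_injective (⟨p, hp⟩ : F)))⟩
    have hd : ‖d‖ ≤ 1 / (N + 1) := by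
      refine le_trans ?_ (le_of_lt hyd)
      rw [dist_comm, dist_eq_norm]
      refine le_of_sq_le_sq ?_ (norm_nonneg _)
      rw [lp_two_norm_sq, lp_two_norm_sq]
      exact tsum_comp_le_tsum_of_inj (lp_two_summable (ampl _ B x - ampl _ A x))
        (fun _ => sq_nonneg _) (Prod.mk_right_injective (⟨p, hp⟩ : F))
    have hsum : ∀ C : H →L[ℂ] H, Summable fun n => ⟪p.1.1 n, C (p.1.2 n)⟫_ℂ := fun C =>
      lp.summable_inner (𝕜 := ℂ) a (ampl ℕ C ⟨p.1.2, memℓp_two_iff.2 p.2.2⟩)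
    rw [← (hsum _).tsum_sub (hsum _)]
    have h1 : ∑' n, (⟪p.1.1 n, B (p.1.2 n)⟫_ℂ - ⟪p.1.1 n, (A : H →L[ℂ] H) (p.1.2 n)⟫_ℂ) =
        ⟪a, d⟫_ℂ := by
      rw [lp.inner_eq_tsum]
      refine tsum_congr fun n => ?_
      rw [← inner_sub_right]
      rfl
    have h2 : ‖a‖ = Real.sqrt (∑' n, ‖p.1.1 n‖ ^ 2) := by
      rw [← Real.sqrt_sq (norm_nonneg a), lp_two_norm_sq]
    refine (congrArg norm h1).le.trans ((norm_inner_le_norm _ _).trans ?_)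
    rw [h2]
    exact mul_le_mul_of_nonneg_left hd (Real.sqrt_nonneg _)
  choose B hB hBA using key
  let := weakStarTopology (VN lam)
  refine mem_closure_of_tendsto (b := atTop) (f := B) ?_ (Eventually.of_forall hB)
  rw [tendsto_weakStar_iff]
  intro p
  rw [tendsto_iff_norm_sub_tendsto_zero]
  have h0 : Tendsto (fun i : Finset (UltraweakIndex H) × ℕ =>
      Real.sqrt (∑' n, ‖p.1.1 n‖ ^ 2) * (1 / ((i.2 : ℝ) + 1))) atTop (𝓝 0) := by
    have h1 := (tendsto_one_div_add_atTop_nhds_zero_nat (𝕜 := ℝ)).const_mul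
      (Real.sqrt (∑' n, ‖p.1.1 n‖ ^ 2))
    rw [mul_zero] at h1
    refine h1.comp ?_
    rw [← prod_atTop_atTop_eq]
    exact tendsto_snd
  refine squeeze_zero' (Eventually.of_forall fun _ => norm_nonneg _) ?_ h0
  filter_upwards [eventually_ge_atTop ({p}, 0)] with i hi
  exact hBA i p (hi.1 (Finset.mem_singleton_self p))

end Ultraweak

/-! ### The Hilbert tensor square and its blocks -/

noncomputable section HilbertTensor

section Basic

variable {H : Type u} [NormedAddCommGroup H] [InnerProductSpace ℂ H]

variable (H) in
/-- The elementary tensors in `H ⊗₂ H`. -/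
def htmul : H →L[ℂ] H →L[ℂ] HilbertSq H :=
  (ContinuousLinearMap.compL ℂ H (H ⊗[ℂ] H) (HilbertSq H) UniformSpace.Completion.toComplL) ∘L
    TensorProduct.mkL ℂ H H

theorem htmul_apply (x y : H) : htmul H x y = ((x ⊗ₜ[ℂ] y : H ⊗[ℂ] H) : HilbertSq H) := rfl

theorem htmul_smul_smul (c d : ℂ) (x y : H) :
    htmul H (c • x) (d • y) = (c * d) • htmul H x y := by
  rw [map_smul, map_smul, smul_apply, smul_smul, mul_comm]

theorem htmul_sum_sum {ι κ : Type*} [Fintype ι] [Fintype κ] (c : ι → ℂ) (d : κ → ℂ) (x : ι → H)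
    (y : κ → H) : htmul H (∑ a, c a • x a) (∑ b, d b • y b) =
      ∑ p : ι × κ, (c p.1 * d p.2) • htmul H (x p.1) (y p.2) := by
  rw [Fintype.sum_prod_type, map_sum (htmul H), sum_apply]
  refine Finset.sum_congr rfl fun a _ => ?_
  rw [map_sum]
  exact Finset.sum_congr rfl fun b _ => htmul_smul_smul _ _ _ _

theorem inner_htmul (x y x' y' : H) :
    ⟪htmul H x y, htmul H x' y'⟫_ℂ = ⟪x, x'⟫_ℂ * ⟪y, y'⟫_ℂ := by
  rw [htmul_apply, htmul_apply, UniformSpace.Completion.inner_coe, TensorProduct.inner_tmul]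

theorem tensorOp_htmul (A B : H →L[ℂ] H) (x y : H) :
    tensorOp A B (htmul H x y) = htmul H (A x) (B y) := by
  rw [htmul_apply, tensorOp, ContinuousLinearMap.completion_apply_coe, TensorProduct.mapL_tmul]
  rfl

theorem htmul_ext {F : Type*} [NormedAddCommGroup F] [NormedSpace ℂ F] {A B : HilbertSq H →L[ℂ] F}
    (h : ∀ x y, A (htmul H x y) = B (htmul H x y)) : A = B := by
  refine DFunLike.coe_injective (UniformSpace.Completion.denseRange_coe.equalizer A.continuous
    B.continuous (funext fun z => ?_))
  change A (z : HilbertSq H) = B (z : HilbertSq H)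
  induction z using TensorProduct.induction_on with
  | zero => rw [UniformSpace.Completion.coe_zero, map_zero, map_zero]
  | tmul x y => exact h x y
  | add x y hx hy => rw [UniformSpace.Completion.coe_add, map_add, map_add, hx, hy]

theorem inner_tensorOp [CompleteSpace H] (A B : H →L[ℂ] H) (x y : HilbertSq H) :
    ⟪tensorOp (star A) (star B) x, y⟫_ℂ = ⟪x, tensorOp A B y⟫_ℂ := by
  have h : tensorOp (star A) (star B) = ContinuousLinearMap.adjoint (tensorOp A B) := by
    refine htmul_ext fun x y => ext_inner_right ℂ fun z => ?_
    rw [ContinuousLinearMap.adjoint_inner_left, tensorOp_htmul]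
    have h1 : innerSL ℂ (htmul H ((star A : H →L[ℂ] H) x) ((star B : H →L[ℂ] H) y)) =
        innerSL ℂ (htmul H x y) ∘L tensorOp A B := by
      refine htmul_ext fun x' y' => ?_
      rw [ContinuousLinearMap.comp_apply, tensorOp_htmul, innerSL_apply_apply, innerSL_apply_apply,
        inner_htmul, inner_htmul, ContinuousLinearMap.star_eq_adjoint,
        ContinuousLinearMap.star_eq_adjoint, ContinuousLinearMap.adjoint_inner_left,
        ContinuousLinearMap.adjoint_inner_left]
    exact DFunLike.congr_fun h1 z
  rw [h, ContinuousLinearMap.adjoint_inner_left]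

theorem star_tensorOp [CompleteSpace H] (A B : H →L[ℂ] H) :
    star (tensorOp A B) = tensorOp (star A) (star B) := by
  rw [ContinuousLinearMap.star_eq_adjoint, eq_comm, ContinuousLinearMap.eq_adjoint_iff]
  exact inner_tensorOp A B

variable {G : Type v} [Group G]

theorem mem_VNSq_iff [CompleteSpace H] {lam : G →* (H ≃ₗᵢ[ℂ] H)}
    {A : HilbertSq H →L[ℂ] HilbertSq H} :
    A ∈ (VNSq lam).toStarSubalgebra ↔ ∀ B : HilbertSq H →L[ℂ] HilbertSq H,
      (∀ s t, tensorOp (unitaryOp lam s) (unitaryOp lam t) * B =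
        B * tensorOp (unitaryOp lam s) (unitaryOp lam t)) → B * A = A * B := by
  rw [VNSq, mem_generatedVN_iff]
  · exact forall_congr' fun B => imp_congr_left (by rw [Set.forall_mem_range, Prod.forall])
  · rintro _ ⟨p, rfl⟩
    refine ⟨p⁻¹, ?_⟩
    rw [star_tensorOp, star_unitaryOp, star_unitaryOp]
    rfl

end Basic

variable {G : Type u} [Group G] [TopologicalSpace G]

theorem regBlock_htmul_ext {F : Type*} [NormedAddCommGroup F] [NormedSpace ℂ F]
    {A B : HilbertSq (RegSpace G) →L[ℂ] F}
    (h : ∀ i j v w, A (htmul (RegSpace G) (blockIncl RegBlock i v) (blockIncl RegBlock j w)) =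
      B (htmul (RegSpace G) (blockIncl RegBlock i v) (blockIncl RegBlock j w))) : A = B := by
  refine htmul_ext fun x y => ?_
  have h1 : A ∘L (htmul (RegSpace G)).flip y = B ∘L (htmul (RegSpace G)).flip y := by
    refine blockIncl_ext fun i v => ?_
    have h2 : A ∘L htmul (RegSpace G) (blockIncl RegBlock i v) = B ∘L htmul (RegSpace G) (blockIncl RegBlock i v) :=
      blockIncl_ext fun j w => h i j v w
    exact DFunLike.congr_fun h2 y
  exact DFunLike.congr_fun h1 x

/-- The basis vectors of `RegSpace G`. -/
def regVec (i : DualIndex G) (a : Fin i.1.dim) : RegSpace G :=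
  blockIncl RegBlock i (EuclideanSpace.single a 1)

theorem blockIncl_eq_sum (i : DualIndex G) (v : RegBlock i) :
    blockIncl RegBlock i v = ∑ a, v a • regVec i a := by
  conv_lhs => rw [← (EuclideanSpace.basisFun (Fin i.1.dim) ℂ).sum_repr v]
  rw [map_sum]
  refine Finset.sum_congr rfl fun a _ => ?_
  rw [map_smul, EuclideanSpace.basisFun_repr, EuclideanSpace.basisFun_apply]
  rfl

theorem inner_regVec (i : DualIndex G) (a b : Fin i.1.dim) :
    ⟪regVec i a, regVec i b⟫_ℂ = if a = b then 1 else 0 := by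
  rw [regVec, regVec, inner_blockIncl_left, blockIncl_apply_self]
  simp [EuclideanSpace.inner_single_left]

theorem inner_regVec_ne {i j : DualIndex G} (h : i ≠ j) (a : Fin i.1.dim) (b : Fin j.1.dim) :
    ⟪regVec i a, regVec j b⟫_ℂ = 0 := by
  rw [regVec, regVec, inner_blockIncl_left, blockIncl_apply_ne h, inner_zero_right]

theorem regularRep_regVec (s : G) (i : DualIndex G) (a : Fin i.1.dim) :
    unitaryOp (regularRep G) s (regVec i a) = ∑ b, star (i.1.rep.mat s b a) • regVec i b := by
  rw [regVec, regularRep_blockIncl, blockIncl_eq_sum]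
  refine Finset.sum_congr rfl fun b _ => ?_
  congr 1
  rw [MatrixRep.isometries_apply, conj_mat]
  simp [Matrix.mulVec, dotProduct]

theorem diagOp_regVec {f : Dual G → ℝ} {K : ℝ} (hf : ∀ π, |f π| ≤ K) (i : DualIndex G)
    (a : Fin i.1.dim) : diagOp f hf (regVec i a) = (f i.1 : ℂ) • regVec i a :=
  diagOp_blockIncl f hf i _

/-- The embedding of `ℂ^(d × d')` as the tensor product of two blocks. -/
def tensorEmb (i j : DualIndex G) :
    (Fin i.1.dim × Fin j.1.dim → ℂ) →ₗ[ℂ] HilbertSq (RegSpace G) :=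
  ∑ a : Fin i.1.dim, ∑ b : Fin j.1.dim,
    (LinearMap.proj (a, b)).smulRight (htmul (RegSpace G) (regVec i a) (regVec j b))

theorem tensorEmb_apply (i j : DualIndex G) (w : Fin i.1.dim × Fin j.1.dim → ℂ) :
    tensorEmb i j w = ∑ a, ∑ b, w (a, b) • htmul (RegSpace G) (regVec i a) (regVec j b) := by
  simp [tensorEmb, LinearMap.sum_apply]

theorem tensorEmb_apply' (i j : DualIndex G) (w : Fin i.1.dim × Fin j.1.dim → ℂ) :
    tensorEmb i j w = ∑ p : Fin i.1.dim × Fin j.1.dim,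
      w p • htmul (RegSpace G) (regVec i p.1) (regVec j p.2) := by
  rw [tensorEmb_apply, Fintype.sum_prod_type]

theorem inner_tensorEmb (i j : DualIndex G) (w w' : Fin i.1.dim × Fin j.1.dim → ℂ) :
    ⟪tensorEmb i j w, tensorEmb i j w'⟫_ℂ = star w ⬝ᵥ w' := by
  rw [tensorEmb_apply', tensorEmb_apply', sum_inner]
  refine Finset.sum_congr rfl fun p _ => ?_
  rw [inner_sum, Finset.sum_eq_single p]
  · rw [inner_smul_left, inner_smul_right, inner_htmul, inner_regVec, inner_regVec]
    simp
  · intro q _ hqp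
    rw [inner_smul_left, inner_smul_right, inner_htmul, inner_regVec, inner_regVec]
    by_cases h1 : p.1 = q.1
    · have h2 : p.2 ≠ q.2 := fun h2 => hqp (Prod.ext h1 h2).symm
      simp [h2]
    · simp [h1]
  · simp

theorem inner_tensorEmb_ne {i j i' j' : DualIndex G} (h : (i, j) ≠ (i', j'))
    (w : Fin i.1.dim × Fin j.1.dim → ℂ) (w' : Fin i'.1.dim × Fin j'.1.dim → ℂ) :
    ⟪tensorEmb i j w, tensorEmb i' j' w'⟫_ℂ = 0 := by
  rw [tensorEmb_apply', tensorEmb_apply', sum_inner]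
  refine Finset.sum_eq_zero fun p _ => ?_
  rw [inner_sum]
  refine Finset.sum_eq_zero fun q _ => ?_
  rw [inner_smul_left, inner_smul_right, inner_htmul]
  by_cases h1 : i = i'
  · have h2 : j ≠ j' := fun h2 => h (Prod.ext h1 h2)
    rw [inner_regVec_ne h2, mul_zero, mul_zero, mul_zero]
  · rw [inner_regVec_ne h1, zero_mul, mul_zero, mul_zero]

theorem tensorOp_diagOp_tensorEmb {f g : Dual G → ℝ} {K K' : ℝ} (hf : ∀ π, |f π| ≤ K)
    (hg : ∀ π, |g π| ≤ K') (i j : DualIndex G) (w : Fin i.1.dim × Fin j.1.dim → ℂ) :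
    tensorOp (diagOp f hf) (diagOp g hg) (tensorEmb i j w) =
      ((f i.1 * g j.1 : ℝ) : ℂ) • tensorEmb i j w := by
  rw [tensorEmb_apply', map_sum, Finset.smul_sum]
  refine Finset.sum_congr rfl fun p _ => ?_
  rw [map_smul, tensorOp_htmul, diagOp_regVec, diagOp_regVec, htmul_smul_smul, smul_comm,
    Complex.ofReal_mul]

/-- The blocks carry conjugate representations, and $\bar\rho(s)w$ read as a row vector is
$w\,\rho(s)^*$. In this form intertwiners of the original, unconjugated representations act on
coefficients by right multiplication. -/
theorem tensorOp_regularRep_tensorEmb (s : G) (i j : DualIndex G)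
    (w : Fin i.1.dim × Fin j.1.dim → ℂ) :
    tensorOp (unitaryOp (regularRep G) s) (unitaryOp (regularRep G) s) (tensorEmb i j w) =
      tensorEmb i j (Matrix.vecMul w ((i.1.rep.tensor j.1.rep).mat s).conjTranspose) := by
  have h1 : ∀ p : Fin i.1.dim × Fin j.1.dim,
      tensorOp (unitaryOp (regularRep G) s) (unitaryOp (regularRep G) s)
        (htmul (RegSpace G) (regVec i p.1) (regVec j p.2)) =
      ∑ q : Fin i.1.dim × Fin j.1.dim, ((i.1.rep.tensor j.1.rep).mat s).conjTranspose p q •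
        htmul (RegSpace G) (regVec i q.1) (regVec j q.2) := by
    intro p
    rw [tensorOp_htmul, regularRep_regVec, regularRep_regVec, htmul_sum_sum]
    refine Finset.sum_congr rfl fun q _ => ?_
    congr 1
    exact (star_mul' (i.1.rep.mat s q.1 p.1) (j.1.rep.mat s q.2 p.2)).symm
  rw [tensorEmb_apply', map_sum, tensorEmb_apply']
  simp only [map_smul, h1, Finset.smul_sum, Matrix.vecMul, dotProduct, Finset.sum_smul, smul_smul]
  exact Finset.sum_comm

theorem htmul_blockIncl (i j : DualIndex G) (v : RegBlock i) (w : RegBlock j) :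
    htmul (RegSpace G) (blockIncl RegBlock i v) (blockIncl RegBlock j w) =
      tensorEmb i j (fun q => v q.1 * w q.2) := by
  rw [blockIncl_eq_sum, blockIncl_eq_sum, htmul_sum_sum, tensorEmb_apply']

/-- The orthogonal projection onto `M` is a bounded operator that agrees with the identity on
tensors of block vectors, and bounded operators are determined there. -/
theorem eq_top_of_tensorEmb_mem {M : Submodule ℂ (HilbertSq (RegSpace G))}
    (hM : IsClosed (M : Set (HilbertSq (RegSpace G))))
    (h : ∀ (p : DualIndex G × DualIndex G) w, tensorEmb p.1 p.2 w ∈ M) : M = ⊤ := by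
  have : CompleteSpace M := hM.completeSpace_coe
  have h1 : M.starProjection = ContinuousLinearMap.id ℂ (HilbertSq (RegSpace G)) := by
    refine regBlock_htmul_ext fun i j v w => ?_
    refine Submodule.starProjection_eq_self_iff.2 ?_
    rw [htmul_blockIncl]
    exact h (i, j) _
  refine Submodule.eq_top_iff'.2 fun x => ?_
  rw [← Submodule.starProjection_eq_self_iff (K := M), h1]
  rfl

end HilbertTensor

/-! ### Irreducible summands of $\lambda\otimes\lambda$ -/

noncomputable section Fusion

variable {G : Type u} [Group G] [TopologicalSpace G]

/-- The blocks of a unitary matrix that decomposes a representation. -/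
theorem exists_blocks {κ : Type*} [Fintype κ] [DecidableEq κ] {ρ : MatrixRep G κ} {n : ℕ}
    {τ : Fin n → Dual G} (h : ρ.Equivalent (MatrixRep.directSum fun i => (τ i).rep)) :
    ∃ X : ∀ k, Matrix (Fin (τ k).dim) κ ℂ,
      (∀ k, X k * (X k).conjTranspose = 1) ∧
      (∀ k l, k ≠ l → X k * (X l).conjTranspose = 0) ∧
      (∀ k s, X k * ρ.mat s = (τ k).rep.mat s * X k) ∧
      ∑ k, (X k).conjTranspose * X k = 1 := by
  obtain ⟨U, h1, h2, h3⟩ := h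
  let X : ∀ k, Matrix (Fin (τ k).dim) κ ℂ := fun k c => U ⟨k, c⟩
  have hX : ∀ k l c d, (X k * (X l).conjTranspose) c d =
      (1 : Matrix (Σ k, Fin (τ k).dim) (Σ k, Fin (τ k).dim) ℂ) ⟨k, c⟩ ⟨l, d⟩ := fun k l c d => by
    rw [← h2]
    rfl
  refine ⟨X, fun k => ?_, fun k l hkl => ?_, fun k s => ?_, ?_⟩
  · ext c d
    rw [hX, Matrix.one_apply, Matrix.one_apply]
    simp
  · ext c d
    rw [hX, Matrix.one_apply_ne]
    · rfl
    · exact fun h => hkl (congrArg Sigma.fst h)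
  · ext c a
    calc _ = (U * ρ.mat s) ⟨k, c⟩ a := rfl
      _ = (Matrix.blockDiagonal' (fun i => (τ i).rep.mat s) * U) ⟨k, c⟩ a := by
        rw [h3]
        rfl
      _ = _ := by
        rw [Matrix.mul_apply, Matrix.mul_apply, Fintype.sum_sigma, Finset.sum_eq_single k]
        · simp [X]
        · intro j _ hjk
          refine Finset.sum_eq_zero fun d _ => ?_
          rw [Matrix.blockDiagonal'_apply_ne _ _ _ (Ne.symm hjk), zero_mul]
        · simp
  · rw [← h1]
    ext a b
    rw [Matrix.sum_apply, Matrix.mul_apply, Fintype.sum_sigma]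
    rfl

/-- The isometry `v ↦ vX` into the tensor product of two blocks. -/
def tensorIsometry (i j : DualIndex G) {m : ℕ} (X : Matrix (Fin m) (Fin i.1.dim × Fin j.1.dim) ℂ)
    (hX : X * X.conjTranspose = 1) :
    EuclideanSpace ℂ (Fin m) →ₗᵢ[ℂ] HilbertSq (RegSpace G) :=
  LinearMap.isometryOfInner (tensorEmb i j ∘ₗ X.vecMulLinear ∘ₗ
    (WithLp.linearEquiv 2 ℂ (Fin m → ℂ)).toLinearMap) fun v w => by
      change ⟪tensorEmb i j (Matrix.vecMul v.ofLp X), tensorEmb i j (Matrix.vecMul w.ofLp X)⟫_ℂ = _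
      rw [inner_tensorEmb, EuclideanSpace.inner_eq_star_dotProduct, Matrix.star_vecMul,
        dotProduct_comm, ← Matrix.dotProduct_mulVec, Matrix.mulVec_mulVec, hX, Matrix.one_mulVec]

theorem tensorIsometry_apply (i j : DualIndex G) {m : ℕ}
    (X : Matrix (Fin m) (Fin i.1.dim × Fin j.1.dim) ℂ) (hX : X * X.conjTranspose = 1)
    (v : EuclideanSpace ℂ (Fin m)) :
    tensorIsometry i j X hX v = tensorEmb i j (Matrix.vecMul v.ofLp X) := rfl

/-- `Q` embeds the conjugate of `σ` into the tensor product of the blocks `i` and `j`. -/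
structure IsFusion (i j : DualIndex G) (σ : Dual G)
    (Q : EuclideanSpace ℂ (Fin σ.dim) →ₗᵢ[ℂ] HilbertSq (RegSpace G)) : Prop where
  mem_range : ∀ v, Q v ∈ LinearMap.range (tensorEmb i j)
  intertwine : ∀ s v, tensorOp (unitaryOp (regularRep G) s) (unitaryOp (regularRep G) s) (Q v) =
    Q (σ.rep.conj.isometries s v)

/-- The intertwining relation at $s^{-1}$ reads $X\rho(s)^*=\sigma(s)^*X$. So $vX\mapsto
vX\rho(s)^*$ corresponds to $v\mapsto v\,\sigma(s)^*$, which is the action of the conjugate of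
$\sigma$. -/
theorem isFusion_tensorIsometry {i j : DualIndex G} {σ : Dual G}
    {X : Matrix (Fin σ.dim) (Fin i.1.dim × Fin j.1.dim) ℂ} (hX : X * X.conjTranspose = 1)
    (h : ∀ s, X * (i.1.rep.tensor j.1.rep).mat s = σ.rep.mat s * X) :
    IsFusion i j σ (tensorIsometry i j X hX) where
  mem_range v := ⟨_, rfl⟩
  intertwine s v := by
    rw [tensorIsometry_apply, tensorIsometry_apply, tensorOp_regularRep_tensorEmb,
      Matrix.vecMul_vecMul, ← MatrixRep.mat_inv, h, MatrixRep.mat_inv, ← Matrix.vecMul_vecMul,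
      MatrixRep.isometries_apply, conj_mat]
    congr 2
    ext a
    simp [Matrix.vecMul, Matrix.mulVec, dotProduct, mul_comm]

theorem IsFusion.tensorOp_diagOp {i j : DualIndex G} {σ : Dual G}
    {Q : EuclideanSpace ℂ (Fin σ.dim) →ₗᵢ[ℂ] HilbertSq (RegSpace G)} (hQ : IsFusion i j σ Q)
    {f g : Dual G → ℝ} {K K' : ℝ} (hf : ∀ π, |f π| ≤ K) (hg : ∀ π, |g π| ≤ K')
    (v : EuclideanSpace ℂ (Fin σ.dim)) :
    tensorOp (diagOp f hf) (diagOp g hg) (Q v) = ((f i.1 * g j.1 : ℝ) : ℂ) • Q v := by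
  obtain ⟨w, hw⟩ := hQ.mem_range v
  rw [← hw, tensorOp_diagOp_tensorEmb]

variable (G) in
/-- A decomposition of `H ⊗₂ H` into irreducible subrepresentations of `lam ⊗ lam`. -/
structure FusionSystem where
  /-- The index set. -/
  J : Type u
  /-- The left factor. -/
  left : J → DualIndex G
  /-- The right factor. -/
  right : J → DualIndex G
  /-- The class of the summand. -/
  cls : J → Dual G
  /-- The embedding of the summand. -/
  Q : ∀ j, EuclideanSpace ℂ (Fin (cls j).dim) →ₗᵢ[ℂ] HilbertSq (RegSpace G)
  isFusion : ∀ j, IsFusion (left j) (right j) (cls j) (Q j)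
  mem_supp : ∀ j, cls j ∈ supp ((left j).1.rep.tensor (right j).1.rep)
  isHilbertSum : IsHilbertSum ℂ (fun j => EuclideanSpace ℂ (Fin (cls j).dim)) Q

/-- Each tensor product of two blocks is decomposed separately. Working inside one pair of blocks
keeps $W^{-1}\otimes W^{-1}$ scalar on every summand. -/
theorem nonempty_fusionSystem : Nonempty (FusionSystem G) := by
  choose n τ hτ using fun p : DualIndex G × DualIndex G =>
    exists_equivalent_directSum (p.1.1.rep.tensor p.2.1.rep)
  choose X hX1 hX2 hX3 hX4 using fun p => exists_blocks (hτ p)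
  refine ⟨{
    J := Σ p : DualIndex G × DualIndex G, Fin (n p)
    left := fun j => j.1.1
    right := fun j => j.1.2
    cls := fun j => τ j.1 j.2
    Q := fun j => tensorIsometry j.1.1 j.1.2 (X j.1 j.2) (hX1 j.1 j.2)
    isFusion := fun j => isFusion_tensorIsometry _ (hX3 j.1 j.2)
    mem_supp := fun j => ⟨n j.1, τ j.1, hτ j.1, j.2, rfl⟩
    isHilbertSum := IsHilbertSum.mk ?_ ?_ }⟩
  · rintro ⟨p, k⟩ ⟨q, l⟩ hne v w
    rw [tensorIsometry_apply, tensorIsometry_apply]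
    by_cases hpq : p = q
    · subst hpq
      have hkl : l ≠ k := fun h => hne (by rw [h])
      rw [inner_tensorEmb, Matrix.star_vecMul, dotProduct_comm, ← Matrix.dotProduct_mulVec,
        Matrix.mulVec_mulVec, hX2 p l k hkl, Matrix.zero_mulVec, dotProduct_zero]
    · exact inner_tensorEmb_ne hpq _ _
  · set M := (⨆ j : Σ p : DualIndex G × DualIndex G, Fin (n p), LinearMap.range
      (tensorIsometry j.1.1 j.1.2 (X j.1 j.2) (hX1 j.1 j.2)).toLinearMap).topologicalClosure with hM
    have hemb : ∀ (p : DualIndex G × DualIndex G) w, tensorEmb p.1 p.2 w ∈ M := by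
      intro p w
      refine Submodule.le_topologicalClosure _ ?_
      -- This is the resolution of the identity $\sum_kX_k^*X_k=1$ applied to a row vector.
      have hw : w = ∑ k, Matrix.vecMul (Matrix.vecMul w (X p k).conjTranspose) (X p k) := by
        simp only [Matrix.vecMul_vecMul]
        rw [← Matrix.vecMul_sum, hX4, Matrix.vecMul_one]
      rw [hw, map_sum]
      refine Submodule.sum_mem _ fun k _ => ?_
      exact Submodule.mem_iSup_of_mem (⟨p, k⟩ : Σ p : DualIndex G × DualIndex G, Fin (n p))
        ⟨WithLp.toLp 2 (Matrix.vecMul w (X p k).conjTranspose), rfl⟩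
    have hMc : IsClosed (M : Set (HilbertSq (RegSpace G))) :=
      Submodule.isClosed_topologicalClosure _
    rw [eq_top_of_tensorEmb_mem hMc hemb]

end Fusion

/-! ### The graph of $\Phi(W)$ -/

noncomputable section ExtensionGraph

variable {H : Type u} [NormedAddCommGroup H] [InnerProductSpace ℂ H] [CompleteSpace H]
  {K : Type v} [NormedAddCommGroup K] [InnerProductSpace ℂ K] [CompleteSpace K]
  {M : VonNeumannAlgebra H} {N : VonNeumannAlgebra K}

theorem mul_eq_of_isStarProjection_le {P Q : H →L[ℂ] H} (hP : IsStarProjection P)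
    (hQ : IsStarProjection Q) (h : P ≤ Q) : Q * P = P := by
  exact (hP.le_iff_mul_eq_right hQ).1 h

/-- The graph of the operator on `⋃ i, Φ(E i)(K)` whose closure is `Φ(W)`. -/
def extensionGraph (Φ : M.toStarSubalgebra →⋆ₐ[ℂ] N.toStarSubalgebra)
    {ι : Type*} (E WE : ι → M.toStarSubalgebra) : Submodule ℂ (K × K) :=
  ⨆ i, (LinearMap.range (Φ (E i) : K →L[ℂ] K).toLinearMap).map
    (LinearMap.prod LinearMap.id (Φ (WE i) : K →L[ℂ] K).toLinearMap)

variable {Φ : M.toStarSubalgebra →⋆ₐ[ℂ] N.toStarSubalgebra} {W : H →ₗ.[ℂ] H}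
  {ι : Type*} [Preorder ι] {E WE : ι → M.toStarSubalgebra}

theorem IsExtendable.map_isStarProjection (h : IsExtendable Φ W E WE) (i : ι) :
    Φ (E i) * Φ (E i) = Φ (E i) := by
  rw [← map_mul]
  congr 1
  exact Subtype.ext (h.projection i).isIdempotentElem

theorem IsExtendable.mul_eq (h : IsExtendable Φ W E WE) {i j : ι} (hij : i ≤ j) :
    E j * E i = E i :=
  Subtype.ext (mul_eq_of_isStarProjection_le (h.projection i) (h.projection j) (h.monotone i j hij))

/-- Both sides give the value of $W$ at $E_ix=E_jE_ix$, and a graph is single-valued. -/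
theorem IsExtendable.mul_eq' (h : IsExtendable Φ W E WE) {i j : ι} (hij : i ≤ j) :
    WE j * E i = WE i := by
  refine Subtype.ext (ContinuousLinearMap.ext fun x => ?_)
  have h1 := h.mem_graph j ((E i : H →L[ℂ] H) x)
  have h2 := h.mem_graph i x
  have h3 : (E j : H →L[ℂ] H) ((E i : H →L[ℂ] H) x) = (E i : H →L[ℂ] H) x :=
    DFunLike.congr_fun (congrArg Subtype.val (h.mul_eq hij)) x
  rw [h3] at h1
  exact LinearPMap.mem_graph_snd_inj _ h1 h2 rfl

/-- The pieces of the graph are directed, by $E_jE_i=E_i$ and $(WE_j)E_i=WE_i$ for $i\le j$, so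
their supremum is their union. -/
theorem IsExtendable.mem_extensionGraph (h : IsExtendable Φ W E WE) {p : K × K} :
    p ∈ extensionGraph Φ E WE ↔ ∃ i, p.1 ∈ Set.range (Φ (E i) : K →L[ℂ] K) ∧
      p.2 = (Φ (WE i) : K →L[ℂ] K) p.1 := by
  have := h.nonempty
  have := h.directed
  have hmul : ∀ A B : M.toStarSubalgebra, ∀ x, (Φ (A * B) : K →L[ℂ] K) x =
      (Φ A : K →L[ℂ] K) ((Φ B : K →L[ℂ] K) x) := fun A B x => by
    rw [map_mul]
    rfl
  rw [extensionGraph, Submodule.mem_iSup_of_directed]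
  · refine exists_congr fun i => ⟨?_, ?_⟩
    · rintro ⟨_, ⟨x, rfl⟩, rfl⟩
      exact ⟨⟨x, rfl⟩, rfl⟩
    · rintro ⟨⟨x, hx⟩, h2⟩
      exact ⟨p.1, ⟨x, hx⟩, Prod.ext rfl h2.symm⟩
  · refine directed_of_isDirected_le fun i j hij => ?_
    rintro _ ⟨_, ⟨x, rfl⟩, rfl⟩
    refine ⟨(Φ (E i) : K →L[ℂ] K) x, ⟨(Φ (E i) : K →L[ℂ] K) x, ?_⟩, Prod.ext rfl ?_⟩
    · change (Φ (E j) : K →L[ℂ] K) ((Φ (E i) : K →L[ℂ] K) x) = _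
      rw [← hmul, h.mul_eq hij]
    · change (Φ (WE j) : K →L[ℂ] K) ((Φ (E i) : K →L[ℂ] K) x) =
        (Φ (WE i) : K →L[ℂ] K) ((Φ (E i) : K →L[ℂ] K) x)
      rw [← hmul, ← hmul, h.mul_eq' hij, h.mul_eq' le_rfl]

theorem IsExtendable.toLinearPMap_graph (h : IsExtendable Φ W E WE) :
    (extensionGraph Φ E WE).toLinearPMap.graph = extensionGraph Φ E WE := by
  refine Submodule.toLinearPMap_graph_eq _ fun p hp h0 => ?_
  obtain ⟨i, -, h2⟩ := h.mem_extensionGraph.1 hp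
  rw [h2, h0, map_zero]

/-- `LinearPMap.closure` leaves a non-closable operator unchanged, so the inclusion holds in either
case and closability need not be established. -/
theorem IsExtendable.graph_extension_le (h : IsExtendable Φ W E WE) :
    (extension Φ E WE).graph ≤ (extensionGraph Φ E WE).topologicalClosure := by
  change (extensionGraph Φ E WE).toLinearPMap.closure.graph ≤ _
  by_cases hc : (extensionGraph Φ E WE).toLinearPMap.IsClosable
  · rw [← hc.graph_closure_eq_closure_graph, h.toLinearPMap_graph]
  · rw [LinearPMap.closure_def' hc, h.toLinearPMap_graph]
    exact Submodule.le_topologicalClosure _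

theorem IsExtendable.extensionGraph_le (h : IsExtendable Φ W E WE) :
    extensionGraph Φ E WE ≤ (extension Φ E WE).graph := by
  conv_lhs => rw [← h.toLinearPMap_graph]
  exact LinearPMap.le_graph_of_le (LinearPMap.le_closure _)

end ExtensionGraph

/-! ### Intertwiners and weak eigenvectors of $\Gamma(W)$ -/

noncomputable section Intertwiners

variable {H : Type u} [NormedAddCommGroup H] [InnerProductSpace ℂ H] [CompleteSpace H]
  {G : Type v} [Group G] {lam : G →* (H ≃ₗᵢ[ℂ] H)}
  {Γ : (VN lam).toStarSubalgebra →⋆ₐ[ℂ] (VNSq lam).toStarSubalgebra} {R : H →L[ℂ] HilbertSq H}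

theorem IsComultiplication.apply_intertwiner_of_mem_span (hΓ : IsComultiplication lam Γ)
    (hR : ∀ s x, tensorOp (unitaryOp lam s) (unitaryOp lam s) (R x) = R (unitaryOp lam s x))
    {B : H →L[ℂ] H} (hB : B ∈ Submodule.span ℂ (Set.range (unitaryOp lam))) :
    ∃ hB : B ∈ (VN lam).toStarSubalgebra, ∀ x,
      (Γ ⟨B, hB⟩ : HilbertSq H →L[ℂ] HilbertSq H) (R x) = R (B x) := by
  induction hB using Submodule.span_induction with
  | mem B hB =>
    obtain ⟨s, rfl⟩ := hB
    refine ⟨subset_generatedVN _ ⟨s, rfl⟩, fun x => ?_⟩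
    rw [hΓ.map_lam, hR]
  | zero =>
    refine ⟨zero_mem _, fun x => ?_⟩
    have h0 : Γ ⟨0, zero_mem _⟩ = 0 := map_zero Γ
    rw [h0, zero_apply, map_zero]
    rfl
  | add B C _ _ hB hC =>
    obtain ⟨hB, hB'⟩ := hB
    obtain ⟨hC, hC'⟩ := hC
    refine ⟨add_mem hB hC, fun x => ?_⟩
    have h0 : Γ ⟨B + C, add_mem hB hC⟩ = Γ ⟨B, hB⟩ + Γ ⟨C, hC⟩ := map_add Γ ⟨B, hB⟩ ⟨C, hC⟩
    rw [h0, add_apply, map_add, ← hB', ← hC']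
    rfl
  | smul c B _ hB =>
    obtain ⟨hB, hB'⟩ := hB
    refine ⟨SMulMemClass.smul_mem c hB, fun x => ?_⟩
    have h0 : Γ ⟨c • B, SMulMemClass.smul_mem c hB⟩ = c • Γ ⟨B, hB⟩ := map_smul Γ c ⟨B, hB⟩
    rw [h0, smul_apply, map_smul, ← hB']
    rfl

/-- The co-multiplication is implemented by every intertwiner of `lam` and `lam ⊗ lam`. -/
theorem IsComultiplication.apply_intertwiner (hΓ : IsComultiplication lam Γ)
    (hR : ∀ s x, tensorOp (unitaryOp lam s) (unitaryOp lam s) (R x) = R (unitaryOp lam s x))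
    (A : (VN lam).toStarSubalgebra) (x : H) :
    (Γ A : HilbertSq H →L[ℂ] HilbertSq H) (R x) = R ((A : H →L[ℂ] H) x) := by
  refine ext_inner_left ℂ fun u => ?_
  rw [← ContinuousLinearMap.adjoint_inner_left R]
  let := weakStarTopology (VN lam)
  let := weakStarTopology (VNSq lam)
  have hc1 : Continuous fun A : (VN lam).toStarSubalgebra =>
      ⟪u, (Γ A : HilbertSq H →L[ℂ] HilbertSq H) (R x)⟫_ℂ :=
    (continuous_weakStar_inner (VNSq lam) u (R x)).comp hΓ.normal
  have hc2 := continuous_weakStar_inner (VN lam) (ContinuousLinearMap.adjoint R u) x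
  refine congrFun (hc1.ext_on (dense_span_unitaryOp lam) hc2 fun B hB => ?_) A
  obtain ⟨_, h2⟩ := hΓ.apply_intertwiner_of_mem_span hR hB
  change ⟪u, _⟫_ℂ = ⟪_, _⟫_ℂ
  rw [ContinuousLinearMap.adjoint_inner_left, ← h2]

/-- $\Gamma(A)$ is self-adjoint, so it can be moved to the side of $Rv$, where $\Gamma(A)R=RA$
applies. The vector $y$ stays arbitrary. -/
theorem IsComultiplication.inner_intertwiner (hΓ : IsComultiplication lam Γ)
    (hR : ∀ s x, tensorOp (unitaryOp lam s) (unitaryOp lam s) (R x) = R (unitaryOp lam s x))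
    {A : (VN lam).toStarSubalgebra} (hA : IsSelfAdjoint (A : H →L[ℂ] H)) (v : H)
    (y : HilbertSq H) :
    ⟪R v, (Γ A : HilbertSq H →L[ℂ] HilbertSq H) y⟫_ℂ = ⟪R ((A : H →L[ℂ] H) v), y⟫_ℂ := by
  have h1 : star A = A := Subtype.ext hA
  have h2 : star (Γ A : HilbertSq H →L[ℂ] HilbertSq H) = Γ A :=
    congrArg Subtype.val ((map_star Γ A).symm.trans (congrArg Γ h1))
  rw [← hΓ.apply_intertwiner hR, ← ContinuousLinearMap.adjoint_inner_left,
    ← ContinuousLinearMap.star_eq_adjoint, h2]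

/-- An intertwiner maps eigenvectors of `W` to weak eigenvectors of `Γ(W)`. -/
theorem IsComultiplication.inner_of_mem_extension (hΓ : IsComultiplication lam Γ)
    (hR : ∀ s x, tensorOp (unitaryOp lam s) (unitaryOp lam s) (R x) = R (unitaryOp lam s x))
    {W : H →ₗ.[ℂ] H} {ι : Type*} [Preorder ι] {E WE : ι → (VN lam).toStarSubalgebra}
    (h : IsExtendable Γ W E WE) {v : H} {c : ℝ}
    (hv : ∀ i, (WE i : H →L[ℂ] H) v = (c : ℂ) • (E i : H →L[ℂ] H) v)
    {p : HilbertSq H × HilbertSq H} (hp : p ∈ (extension Γ E WE).graph) :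
    ⟪R v, p.2⟫_ℂ = (c : ℂ) * ⟪R v, p.1⟫_ℂ := by
  -- The eigenvalue relation is the vanishing of a continuous functional on pairs. Once it holds on
  -- the graph over $\mathcal D'$, it holds on the closure.
  let Λ : HilbertSq H × HilbertSq H →L[ℂ] ℂ :=
    innerSL ℂ (R v) ∘L ContinuousLinearMap.snd ℂ _ _ -
      (c : ℂ) • (innerSL ℂ (R v) ∘L ContinuousLinearMap.fst ℂ _ _)
  have h1 : extensionGraph Γ E WE ≤ LinearMap.ker Λ.toLinearMap := by
    rintro ⟨y, z⟩ hp
    obtain ⟨i, ⟨x, hx⟩, hz⟩ := h.mem_extensionGraph.1 hp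
    change _ = y at hx
    change z = (Γ (WE i) : HilbertSq H →L[ℂ] HilbertSq H) y at hz
    subst hz
    have h3 : (Γ (E i) : HilbertSq H →L[ℂ] HilbertSq H) y = y := by
      rw [← hx]
      exact DFunLike.congr_fun (congrArg Subtype.val (h.map_isStarProjection i)) x
    change ⟪R v, (Γ (WE i) : HilbertSq H →L[ℂ] HilbertSq H) y⟫_ℂ - (c : ℂ) * ⟪R v, y⟫_ℂ = 0
    rw [hΓ.inner_intertwiner hR (h.selfAdjoint i), hv, map_smul, inner_smul_left,
      Complex.conj_ofReal, ← hΓ.inner_intertwiner hR (h.projection i).isSelfAdjoint, h3, sub_self]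
  exact sub_eq_zero.1 (Submodule.topologicalClosure_minimal _ h1 Λ.isClosed_ker
    (h.graph_extension_le hp))

/-- A common weak eigenvector of `Γ(W)` and `W⁻¹ ⊗ W⁻¹` bounds the product of the eigenvalues. -/
theorem IsWeightAlong.mul_le_one {W : H →ₗ.[ℂ] H} {ι : Type*} [Preorder ι]
    {E WE : ι → (VN lam).toStarSubalgebra} {Winv : (VN lam).toStarSubalgebra}
    (h : IsWeightAlong lam Γ W E WE Winv)
    (hR : ∀ s x, tensorOp (unitaryOp lam s) (unitaryOp lam s) (R x) = R (unitaryOp lam s x))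
    (hself : IsSelfAdjoint (Winv : H →L[ℂ] H)) {v : H} {c d : ℝ} (hv1 : ‖R v‖ = 1)
    (hv : ∀ i, (WE i : H →L[ℂ] H) v = (c : ℂ) • (E i : H →L[ℂ] H) v)
    (hd : tensorOp (Winv : H →L[ℂ] H) (Winv : H →L[ℂ] H) (R v) = (d : ℂ) • R v) : c * d ≤ 1 := by
  obtain ⟨T, hT, hT1⟩ := h.bounded_le_one
  have hS : ∀ x, ⟪R v, tensorOp (Winv : H →L[ℂ] H) (Winv : H →L[ℂ] H) x⟫_ℂ =
      (d : ℂ) * ⟪R v, x⟫_ℂ := by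
    intro x
    rw [← inner_tensorOp, hself.star_eq, hd, inner_smul_left, Complex.conj_ofReal]
  have hcont1 : Continuous fun x => ⟪R v, T x⟫_ℂ := continuous_const.inner T.continuous
  have hcont2 : Continuous fun x => (c : ℂ) * ((d : ℂ) * ⟪R v, x⟫_ℂ) :=
    continuous_const.mul (continuous_const.mul (continuous_const.inner continuous_id))
  -- On the dense set $\mathcal D_0$ the pair $((W^{-1}\otimes W^{-1})x,Tx)$ is in the graph of
  -- $\Gamma(W)$, which produces the factor $c$; the factor $d$ comes from $W^{-1}\otimes W^{-1}$.
  have hTx : (fun x => ⟪R v, T x⟫_ℂ) = fun x => (c : ℂ) * ((d : ℂ) * ⟪R v, x⟫_ℂ) := by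
    refine hcont1.ext_on h.dense_D₀ hcont2 fun x hx => ?_
    have h1 := h.comultiplication.inner_of_mem_extension hR h.extendable hv (hT x hx)
    change ⟪R v, T x⟫_ℂ = (c : ℂ) * ⟪R v, tensorOp (Winv : H →L[ℂ] H) (Winv : H →L[ℂ] H) x⟫_ℂ at h1
    rw [hS] at h1
    exact h1
  have h1 := ((ContinuousLinearMap.le_def _ _).1 hT1).re_inner_nonneg_right (R v)
  have h2 : ⟪R v, T (R v)⟫_ℂ = ((c * d : ℝ) : ℂ) := by
    refine (congrFun hTx (R v)).trans ?_
    rw [inner_self_eq_norm_sq_to_K, hv1]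
    simp
  rw [sub_apply, inner_sub_right, h2, one_apply_eq_self, inner_self_eq_norm_sq_to_K, hv1] at h1
  have h3 : 0 ≤ 1 - c * d := by
    simpa using h1
  linarith

end Intertwiners

/-! ### Necessity of the inequality -/

noncomputable section Necessity

variable {G : Type u} [Group G] [TopologicalSpace G]

/-- A block of the class `σ` in `RegSpace G`. -/
def Dual.index (σ : Dual G) : DualIndex G := ⟨σ, ⟨0, σ.dim_pos⟩⟩

/-- The projection onto a single block intertwines $\lambda$, so elements of the bicommutant commute
with it. -/
theorem VN_apply_blockIncl {A : RegSpace G →L[ℂ] RegSpace G}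
    (hA : A ∈ (VN (regularRep G)).toStarSubalgebra) (i : DualIndex G) (x : RegSpace G) :
    A (blockIncl RegBlock i (x i)) = blockIncl RegBlock i (A x i) := by
  let B : RegSpace G →L[ℂ] RegSpace G := blockIncl RegBlock i ∘L lp.evalCLM ℂ RegBlock 2 i
  have hB : ∀ s, unitaryOp (regularRep G) s * B = B * unitaryOp (regularRep G) s := fun s => by
    ext1 y
    exact regularRep_blockIncl s i (y i)
  exact (DFunLike.congr_fun (mem_VN_iff.1 hA B hB) x).symm

/-- The partial isometry from `RegSpace G` to its tensor square given by `Q`. -/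
def fusionMap {σ : Dual G} (Q : EuclideanSpace ℂ (Fin σ.dim) →ₗᵢ[ℂ] HilbertSq (RegSpace G)) :
    RegSpace G →L[ℂ] HilbertSq (RegSpace G) :=
  Q.toContinuousLinearMap ∘L lp.evalCLM ℂ RegBlock 2 σ.index

theorem IsFusion.fusionMap_intertwine {i j : DualIndex G} {σ : Dual G}
    {Q : EuclideanSpace ℂ (Fin σ.dim) →ₗᵢ[ℂ] HilbertSq (RegSpace G)} (hQ : IsFusion i j σ Q)
    (s : G) (x : RegSpace G) :
    tensorOp (unitaryOp (regularRep G) s) (unitaryOp (regularRep G) s) (fusionMap Q x) =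
      fusionMap Q (unitaryOp (regularRep G) s x) :=
  hQ.intertwine s (x σ.index)

/-- `E` preserves the block, on which $W$ is the scalar $\omega$. This supplies the hypothesis on
$v$ in `IsWeightAlong.mul_le_one` for an arbitrary net. -/
theorem apply_blockIncl_of_mem_graph {ω : Dual G → ℝ} {E WE : RegSpace G →L[ℂ] RegSpace G}
    (hE : E ∈ (VN (regularRep G)).toStarSubalgebra)
    (h : ∀ x, (E x, WE x) ∈ (centralOperator ω).graph) (i : DualIndex G) (e : RegBlock i) :
    WE (blockIncl RegBlock i e) = (ω i.1 : ℂ) • E (blockIncl RegBlock i e) := by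
  have h2 := VN_apply_blockIncl hE i (blockIncl RegBlock i e)
  rw [blockIncl_apply_self] at h2
  ext j : 2
  rw [(mem_centralOperator_graph ω).1 (h (blockIncl RegBlock i e)), lp.coeFn_smul, Pi.smul_apply]
  by_cases hj : j = i
  · subst hj; rfl
  · rw [h2, blockIncl_apply_ne hj, smul_zero, smul_zero]

theorem le_mul_of_isWeightAlong {δ : ℝ} (hδ : 0 < δ) {ω : Dual G → ℝ} (hω : ∀ π, δ < ω π)
    {Γ : (VN (regularRep G)).toStarSubalgebra →⋆ₐ[ℂ] (VNSq (regularRep G)).toStarSubalgebra}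
    {ι : Type*} [Preorder ι] {E WE : ι → (VN (regularRep G)).toStarSubalgebra}
    {Winv : (VN (regularRep G)).toStarSubalgebra}
    (h : IsWeightAlong (regularRep G) Γ (centralOperator ω) E WE Winv)
    {σ π π' : Dual G} (hσ : σ ∈ supp (π.rep.tensor π'.rep)) : ω σ ≤ ω π * ω π' := by
  obtain ⟨n, τ, hτ, k, rfl⟩ := hσ
  obtain ⟨X, hX1, -, hX3, -⟩ := exists_blocks hτ
  have hQ : IsFusion π.index π'.index (τ k) (tensorIsometry π.index π'.index (X k) (hX1 k)) :=
    isFusion_tensorIsometry (hX1 k) (hX3 k)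
  generalize tensorIsometry π.index π'.index (X k) (hX1 k) = Q at hQ
  -- A bounded inverse is unique, so the given one is the diagonal operator.
  have hinv : (Winv : RegSpace G →L[ℂ] RegSpace G) =
      diagOp (fun π => (ω π)⁻¹) (abs_inv_le hδ hω) :=
    ContinuousLinearMap.ext fun x => ((isBoundedInverse_diagOp hδ hω).2 _ _ (h.inverse.1 x)).symm
  have hself : IsSelfAdjoint (Winv : RegSpace G →L[ℂ] RegSpace G) :=
    hinv ▸ isSelfAdjoint_diagOp _ _
  let e : RegBlock (τ k).index := EuclideanSpace.single ⟨0, (τ k).dim_pos⟩ 1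
  have he : ‖e‖ = 1 := (PiLp.norm_single _ _ _ _).trans norm_one
  have hRe : fusionMap Q (blockIncl RegBlock (τ k).index e) = Q e :=
    congrArg Q (blockIncl_apply_self (V := RegBlock) (τ k).index e)
  have h1 : ω (τ k) * ((ω π)⁻¹ * (ω π')⁻¹) ≤ 1 := by
    refine h.mul_le_one hQ.fusionMap_intertwine hself (v := blockIncl RegBlock (τ k).index e) ?_
      (fun i => apply_blockIncl_of_mem_graph (E i).2 (h.extendable.mem_graph i) _ e) ?_
    · rw [hRe]
      exact (Q.norm_map e).trans he
    · rw [hRe, hinv]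
      exact hQ.tensorOp_diagOp _ _ e
  have hp := hδ.trans (hω π)
  have hp' := hδ.trans (hω π')
  have h3 : ω (τ k) = ω (τ k) * ((ω π)⁻¹ * (ω π')⁻¹) * (ω π * ω π') := by
    field_simp
  rw [h3]
  exact mul_le_of_le_one_left (mul_pos hp hp').le h1

end Necessity

/-! ### Block-diagonal operators on an internal Hilbert sum -/

noncomputable section HilbertSumOperators

variable {K : Type u} [NormedAddCommGroup K] [InnerProductSpace ℂ K] [CompleteSpace K]
  {J : Type v} {V : J → Type w} [∀ j, NormedAddCommGroup (V j)] [∀ j, InnerProductSpace ℂ (V j)]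
  {Q : ∀ j, V j →ₗᵢ[ℂ] K} (hQ : IsHilbertSum ℂ V Q)

theorem hilbertSum_ext (hQ : IsHilbertSum ℂ V Q) {F : Type*} [NormedAddCommGroup F] [NormedSpace ℂ F] {A B : K →L[ℂ] F}
    (h : ∀ j v, A (Q j v) = B (Q j v)) : A = B := by
  ext x
  have hs := hQ.hasSum_linearIsometryEquiv_symm (hQ.linearIsometryEquiv x)
  rw [LinearIsometryEquiv.symm_apply_apply] at hs
  have hA := A.hasSum hs
  simp only [h] at hA
  exact hA.unique (B.hasSum hs)

/-- The component of `x` in the summand `j`. -/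
def hilbertCoord (x : K) (j : J) : V j := hQ.linearIsometryEquiv x j

theorem hasSum_hilbertCoord (x : K) : HasSum (fun j => Q j (hilbertCoord hQ x j)) x := by
  have hs := hQ.hasSum_linearIsometryEquiv_symm (hQ.linearIsometryEquiv x)
  rwa [LinearIsometryEquiv.symm_apply_apply] at hs

theorem hilbertCoord_ext {x y : K} (h : ∀ j, hilbertCoord hQ x j = hilbertCoord hQ y j) :
    x = y := by
  apply hQ.linearIsometryEquiv.injective
  ext j : 2
  exact h j

theorem linearIsometryEquiv_apply (j : J) (v : V j) :
    hQ.linearIsometryEquiv (Q j v) = blockIncl V j v := by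
  classical
  have h := hQ.linearIsometryEquiv_symm_apply_single v
  rw [← h, LinearIsometryEquiv.apply_symm_apply, blockIncl, lp.singleContinuousLinearMap_apply]

theorem hilbertCoord_apply_self (j : J) (v : V j) : hilbertCoord hQ (Q j v) j = v := by
  rw [hilbertCoord, linearIsometryEquiv_apply, blockIncl_apply_self]

theorem hilbertCoord_apply_ne {j k : J} (h : k ≠ j) (v : V j) :
    hilbertCoord hQ (Q j v) k = 0 := by
  rw [hilbertCoord, linearIsometryEquiv_apply, blockIncl_apply_ne h]

/-- The component in the summand `j`, as a bounded operator. -/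
def hilbertCoordL (j : J) : K →L[ℂ] V j :=
  lp.evalCLM ℂ V 2 j ∘L hQ.linearIsometryEquiv.toContinuousLinearEquiv.toContinuousLinearMap

theorem hilbertCoordL_apply (j : J) (x : K) : hilbertCoordL hQ j x = hilbertCoord hQ x j := rfl

theorem inner_eq_tsum_hilbertCoord (x y : K) :
    ⟪x, y⟫_ℂ = ∑' j, ⟪hilbertCoord hQ x j, hilbertCoord hQ y j⟫_ℂ := by
  rw [← hQ.linearIsometryEquiv.inner_map_map, lp.inner_eq_tsum]
  rfl

theorem hasSum_inner_hilbertCoord (x y : K) :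
    HasSum (fun j => ⟪hilbertCoord hQ x j, hilbertCoord hQ y j⟫_ℂ) ⟪x, y⟫_ℂ := by
  rw [← hQ.linearIsometryEquiv.inner_map_map]
  exact lp.hasSum_inner _ _

theorem summable_hilbertCoord (x : K) : Summable fun j => ‖hilbertCoord hQ x j‖ ^ 2 :=
  lp_two_summable (hQ.linearIsometryEquiv x)

theorem tsum_hilbertCoord (x : K) : ∑' j, ‖hilbertCoord hQ x j‖ ^ 2 = ‖x‖ ^ 2 := by
  rw [← hQ.linearIsometryEquiv.norm_map x, lp_two_norm_sq]
  rfl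

/-- The block-diagonal operator with uniformly bounded blocks `A j`. -/
def hilbertBlockOp (A : ∀ j, V j →L[ℂ] V j) {C : ℝ} (hC : 0 ≤ C) (hA : ∀ j, ‖A j‖ ≤ C) :
    K →L[ℂ] K :=
  hQ.linearIsometryEquiv.symm.toContinuousLinearEquiv.toContinuousLinearMap ∘L
    lp.mapCLM 2 A hC hA ∘L hQ.linearIsometryEquiv.toContinuousLinearEquiv.toContinuousLinearMap

variable {A : ∀ j, V j →L[ℂ] V j} {C : ℝ} (hC : 0 ≤ C) (hA : ∀ j, ‖A j‖ ≤ C)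

theorem hilbertCoord_hilbertBlockOp (x : K) (j : J) :
    hilbertCoord hQ (hilbertBlockOp hQ A hC hA x) j = A j (hilbertCoord hQ x j) := by
  have h : hQ.linearIsometryEquiv (hilbertBlockOp hQ A hC hA x) =
      lp.mapCLM 2 A hC hA (hQ.linearIsometryEquiv x) :=
    hQ.linearIsometryEquiv.apply_symm_apply _
  rw [hilbertCoord, h]
  rfl

theorem hilbertBlockOp_apply (j : J) (v : V j) :
    hilbertBlockOp hQ A hC hA (Q j v) = Q j (A j v) := by
  refine hilbertCoord_ext hQ fun k => ?_
  rw [hilbertCoord_hilbertBlockOp]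
  by_cases h : k = j
  · subst h
    rw [hilbertCoord_apply_self, hilbertCoord_apply_self]
  · rw [hilbertCoord_apply_ne hQ h, hilbertCoord_apply_ne hQ h, map_zero]

theorem inner_hilbertBlockOp (x y : K) : ⟪x, hilbertBlockOp hQ A hC hA y⟫_ℂ =
    ∑' j, ⟪hilbertCoord hQ x j, A j (hilbertCoord hQ y j)⟫_ℂ := by
  rw [inner_eq_tsum_hilbertCoord hQ]
  exact tsum_congr fun j => by rw [hilbertCoord_hilbertBlockOp]

theorem star_hilbertBlockOp {B : ∀ j, V j →L[ℂ] V j} {D : ℝ} (hD : 0 ≤ D) (hB : ∀ j, ‖B j‖ ≤ D)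
    (h : ∀ j v w, ⟪B j v, w⟫_ℂ = ⟪v, A j w⟫_ℂ) :
    star (hilbertBlockOp hQ A hC hA) = hilbertBlockOp hQ B hD hB := by
  rw [ContinuousLinearMap.star_eq_adjoint, eq_comm, ContinuousLinearMap.eq_adjoint_iff]
  intro x y
  rw [inner_hilbertBlockOp, inner_eq_tsum_hilbertCoord hQ]
  exact tsum_congr fun j => by rw [hilbertCoord_hilbertBlockOp, h]

/-- Multiplication of the summands by uniformly bounded scalars. -/
def hilbertScalarOp (c : J → ℝ) {C : ℝ} (hc : ∀ j, |c j| ≤ C) : K →L[ℂ] K :=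
  hilbertBlockOp hQ (fun j => (c j : ℂ) • ContinuousLinearMap.id ℂ (V j)) (abs_nonneg C)
    fun j => norm_ofReal_smul_id_le (hc j)

variable {c : J → ℝ} {C : ℝ} (hc : ∀ j, |c j| ≤ C)

theorem hilbertCoord_hilbertScalarOp (x : K) (j : J) :
    hilbertCoord hQ (hilbertScalarOp hQ c hc x) j = (c j : ℂ) • hilbertCoord hQ x j :=
  hilbertCoord_hilbertBlockOp hQ _ _ x j

theorem hilbertScalarOp_apply (j : J) (v : V j) :
    hilbertScalarOp hQ c hc (Q j v) = (c j : ℂ) • Q j v := by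
  rw [hilbertScalarOp, hilbertBlockOp_apply, smul_apply, map_smul]
  rfl

theorem hilbertScalarOp_le_one (hc1 : ∀ j, c j ≤ 1) : hilbertScalarOp hQ c hc ≤ 1 := by
  rw [ContinuousLinearMap.le_def, ContinuousLinearMap.isPositive_def']
  have hself : star (hilbertScalarOp hQ c hc) = hilbertScalarOp hQ c hc := by
    refine star_hilbertBlockOp hQ _ _ _ _ fun j v w => ?_
    simp only [smul_apply, ContinuousLinearMap.id_apply]
    rw [inner_smul_left, inner_smul_right, Complex.conj_ofReal]
  refine ⟨?_, fun x => ?_⟩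
  · rw [IsSelfAdjoint, star_sub, star_one, hself]
  · rw [ContinuousLinearMap.reApplyInnerSelf_apply, sub_apply, one_apply_eq_self]
    have h1 := hasSum_inner_hilbertCoord hQ (x - hilbertScalarOp hQ c hc x) x
    refine (Complex.hasSum_re h1).nonneg fun j => ?_
    have h2 : hilbertCoord hQ (x - hilbertScalarOp hQ c hc x) j =
        ((1 - c j : ℝ) : ℂ) • hilbertCoord hQ x j := by
      rw [← hilbertCoordL_apply, map_sub, hilbertCoordL_apply, hilbertCoordL_apply,
        hilbertCoord_hilbertScalarOp, Complex.ofReal_sub, sub_smul, Complex.ofReal_one, one_smul]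
    rw [h2, inner_smul_left, Complex.conj_ofReal, Complex.re_ofReal_mul]
    exact mul_nonneg (sub_nonneg.2 (hc1 j)) (inner_self_nonneg (𝕜 := ℂ))

end HilbertSumOperators

/-! ### Construction of the co-multiplication -/

noncomputable section Comultiplication

variable {G : Type u} [Group G] [TopologicalSpace G]

/-- The embedding of a block of the class `σ`. -/
def Dual.incl (σ : Dual G) : EuclideanSpace ℂ (Fin σ.dim) →L[ℂ] RegSpace G :=
  blockIncl RegBlock σ.index

/-- The component in a block of the class `σ`. -/
def Dual.proj (σ : Dual G) : RegSpace G →L[ℂ] EuclideanSpace ℂ (Fin σ.dim) :=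
  lp.evalCLM ℂ RegBlock 2 σ.index

theorem Dual.proj_incl (σ : Dual G) (v : EuclideanSpace ℂ (Fin σ.dim)) :
    σ.proj (σ.incl v) = v :=
  blockIncl_apply_self (V := RegBlock) σ.index v

theorem Dual.inner_incl (σ : Dual G) (v : EuclideanSpace ℂ (Fin σ.dim)) (x : RegSpace G) :
    ⟪σ.incl v, x⟫_ℂ = ⟪v, σ.proj x⟫_ℂ :=
  inner_blockIncl_left (V := RegBlock) σ.index v x

theorem Dual.inner_incl_right (σ : Dual G) (v : EuclideanSpace ℂ (Fin σ.dim)) (x : RegSpace G) :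
    ⟪x, σ.incl v⟫_ℂ = ⟪σ.proj x, v⟫_ℂ :=
  inner_blockIncl_right (V := RegBlock) σ.index v x

theorem Dual.norm_incl (σ : Dual G) (v : EuclideanSpace ℂ (Fin σ.dim)) : ‖σ.incl v‖ = ‖v‖ := by
  rw [@norm_eq_sqrt_re_inner ℂ, σ.inner_incl, σ.proj_incl, ← @norm_eq_sqrt_re_inner ℂ]

theorem Dual.norm_proj_le (σ : Dual G) (x : RegSpace G) : ‖σ.proj x‖ ≤ ‖x‖ :=
  lp.norm_apply_le_norm two_ne_zero x σ.index

theorem Dual.proj_unitaryOp (σ : Dual G) (s : G) (x : RegSpace G) :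
    σ.proj (unitaryOp (regularRep G) s x) = σ.rep.conj.isometries s (σ.proj x) := rfl

theorem Dual.unitaryOp_incl (σ : Dual G) (s : G) (v : EuclideanSpace ℂ (Fin σ.dim)) :
    unitaryOp (regularRep G) s (σ.incl v) = σ.incl (σ.rep.conj.isometries s v) :=
  regularRep_blockIncl s σ.index v

theorem Dual.apply_incl (σ : Dual G) {A : RegSpace G →L[ℂ] RegSpace G}
    (hA : A ∈ (VN (regularRep G)).toStarSubalgebra) (v : EuclideanSpace ℂ (Fin σ.dim)) :
    A (σ.incl v) = σ.incl (σ.proj (A (σ.incl v))) := by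
  have h := VN_apply_blockIncl hA σ.index (σ.incl v)
  have h2 : σ.incl v σ.index = v := blockIncl_apply_self (V := RegBlock) σ.index v
  rw [h2] at h
  exact h

theorem Dual.diagOp_incl (σ : Dual G) {f : Dual G → ℝ} {C : ℝ} (hf : ∀ π, |f π| ≤ C)
    (v : EuclideanSpace ℂ (Fin σ.dim)) : diagOp f hf (σ.incl v) = (f σ : ℂ) • σ.incl v :=
  diagOp_blockIncl f hf σ.index v

/-- The block of the class `σ` of an operator. -/
def Dual.compress (σ : Dual G) (A : RegSpace G →L[ℂ] RegSpace G) :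
    EuclideanSpace ℂ (Fin σ.dim) →L[ℂ] EuclideanSpace ℂ (Fin σ.dim) :=
  σ.proj ∘L A ∘L σ.incl

theorem Dual.compress_apply (σ : Dual G) (A : RegSpace G →L[ℂ] RegSpace G)
    (v : EuclideanSpace ℂ (Fin σ.dim)) : σ.compress A v = σ.proj (A (σ.incl v)) := rfl

theorem Dual.norm_compress_le (σ : Dual G) (A : RegSpace G →L[ℂ] RegSpace G) :
    ‖σ.compress A‖ ≤ ‖A‖ := by
  refine ContinuousLinearMap.opNorm_le_bound _ (norm_nonneg A) fun v => ?_
  rw [σ.compress_apply]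
  refine (σ.norm_proj_le _).trans ((A.le_opNorm _).trans ?_)
  rw [σ.norm_incl]

namespace FusionSystem

variable (F : FusionSystem G)

/-- The operator on `H ⊗₂ H` that acts as the block of `A` on every summand. -/
def comultOp (A : RegSpace G →L[ℂ] RegSpace G) :
    HilbertSq (RegSpace G) →L[ℂ] HilbertSq (RegSpace G) :=
  hilbertBlockOp F.isHilbertSum (fun j => (F.cls j).compress A) (norm_nonneg A)
    fun j => (F.cls j).norm_compress_le A

theorem comultOp_apply (A : RegSpace G →L[ℂ] RegSpace G) (j : F.J)
    (v : EuclideanSpace ℂ (Fin (F.cls j).dim)) :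
    F.comultOp A (F.Q j v) = F.Q j ((F.cls j).proj (A ((F.cls j).incl v))) :=
  hilbertBlockOp_apply F.isHilbertSum _ _ j v

/-- The component in the summand `j`. -/
def coord (x : HilbertSq (RegSpace G)) (j : F.J) : EuclideanSpace ℂ (Fin (F.cls j).dim) :=
  hilbertCoord F.isHilbertSum x j

theorem coord_comultOp (A : RegSpace G →L[ℂ] RegSpace G) (x : HilbertSq (RegSpace G)) (j : F.J) :
    F.coord (F.comultOp A x) j = (F.cls j).proj (A ((F.cls j).incl (F.coord x j))) :=
  hilbertCoord_hilbertBlockOp F.isHilbertSum _ _ x j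

theorem ext {E : Type*} [NormedAddCommGroup E] [NormedSpace ℂ E]
    {A B : HilbertSq (RegSpace G) →L[ℂ] E} (h : ∀ j v, A (F.Q j v) = B (F.Q j v)) : A = B :=
  hilbertSum_ext F.isHilbertSum h

theorem coord_ext {x y : HilbertSq (RegSpace G)} (h : ∀ j, F.coord x j = F.coord y j) : x = y :=
  hilbertCoord_ext F.isHilbertSum h

theorem comultOp_unitaryOp (s : G) : F.comultOp (unitaryOp (regularRep G) s) =
    tensorOp (unitaryOp (regularRep G) s) (unitaryOp (regularRep G) s) := by
  refine F.ext fun j v => ?_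
  rw [comultOp_apply, (F.isFusion j).intertwine, Dual.proj_unitaryOp, Dual.proj_incl]

theorem comultOp_one : F.comultOp 1 = 1 :=
  F.ext fun j v => by
    rw [comultOp_apply, one_apply_eq_self, one_apply_eq_self, Dual.proj_incl]

theorem comultOp_zero : F.comultOp 0 = 0 :=
  F.ext fun j v => by
    rw [comultOp_apply, zero_apply, zero_apply, map_zero, map_zero]

theorem comultOp_add (A B : RegSpace G →L[ℂ] RegSpace G) :
    F.comultOp (A + B) = F.comultOp A + F.comultOp B :=
  F.ext fun j v => by
    rw [comultOp_apply, add_apply, add_apply, map_add, map_add, comultOp_apply, comultOp_apply]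

theorem comultOp_smul (c : ℂ) (A : RegSpace G →L[ℂ] RegSpace G) :
    F.comultOp (c • A) = c • F.comultOp A :=
  F.ext fun j v => by
    rw [comultOp_apply, smul_apply, smul_apply, map_smul, map_smul, comultOp_apply]

/-- Compression to a block is multiplicative here because the right factor, lying in $VN(G)$, maps
the block into itself. -/
theorem comultOp_mul (A : RegSpace G →L[ℂ] RegSpace G) {B : RegSpace G →L[ℂ] RegSpace G}
    (hB : B ∈ (VN (regularRep G)).toStarSubalgebra) :
    F.comultOp (A * B) = F.comultOp A * F.comultOp B :=
  F.ext fun j v => by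
    rw [mul_apply_eq_comp, comultOp_apply, comultOp_apply, comultOp_apply, ← Dual.apply_incl _ hB,
      mul_apply_eq_comp]

theorem comultOp_star (A : RegSpace G →L[ℂ] RegSpace G) :
    F.comultOp (star A) = star (F.comultOp A) := by
  refine (star_hilbertBlockOp F.isHilbertSum _ _ _ _ fun j v w => ?_).symm
  rw [Dual.compress_apply, Dual.compress_apply, ← Dual.inner_incl, ← Dual.inner_incl_right,
    ContinuousLinearMap.star_eq_adjoint, ContinuousLinearMap.adjoint_inner_left]

theorem coord_Q_ne {j k : F.J} (h : k ≠ j) (v : EuclideanSpace ℂ (Fin (F.cls j).dim)) :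
    F.coord (F.Q j v) k = 0 :=
  hilbertCoord_apply_ne F.isHilbertSum h v

/-- The component in the summand `j`, as a bounded operator. -/
def coordL (j : F.J) : HilbertSq (RegSpace G) →L[ℂ] EuclideanSpace ℂ (Fin (F.cls j).dim) :=
  hilbertCoordL F.isHilbertSum j

theorem coord_tensorOp (s : G) (x : HilbertSq (RegSpace G)) (k : F.J) :
    F.coord (tensorOp (unitaryOp (regularRep G) s) (unitaryOp (regularRep G) s) x) k =
      (F.cls k).rep.conj.isometries s (F.coord x k) := by
  rw [← comultOp_unitaryOp, coord_comultOp, Dual.proj_unitaryOp, Dual.proj_incl]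

/-- An operator commuting with all $\lambda(s)\otimes\lambda(s)$ has matrix entries between summands
that intertwine. Transplanted to $H$ such an entry lies in the commutant of $\lambda$, hence
commutes with `A`. -/
theorem comultOp_mem {A : RegSpace G →L[ℂ] RegSpace G}
    (hA : A ∈ (VN (regularRep G)).toStarSubalgebra) :
    F.comultOp A ∈ (VNSq (regularRep G)).toStarSubalgebra := by
  rw [mem_VNSq_iff]
  intro B hB
  refine F.ext fun j v => F.coord_ext fun k => ?_
  rw [mul_apply_eq_comp, mul_apply_eq_comp, coord_comultOp, comultOp_apply]
  let C : RegSpace G →L[ℂ] RegSpace G :=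
    (F.cls k).incl ∘L F.coordL k ∘L B ∘L (F.Q j).toContinuousLinearMap ∘L (F.cls j).proj
  have hC : ∀ y, C y = (F.cls k).incl (F.coord (B (F.Q j ((F.cls j).proj y))) k) := fun y => rfl
  have hCs : ∀ s, unitaryOp (regularRep G) s * C = C * unitaryOp (regularRep G) s := by
    intro s
    refine ContinuousLinearMap.ext fun y => ?_
    rw [mul_apply_eq_comp, mul_apply_eq_comp, hC, hC, Dual.unitaryOp_incl, Dual.proj_unitaryOp,
      ← coord_tensorOp, ← (F.isFusion j).intertwine]
    congr 2
    exact DFunLike.congr_fun (hB s s) _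
  have h1 := congrArg (F.cls k).proj (DFunLike.congr_fun (mem_VN_iff.1 hA C hCs) ((F.cls j).incl v))
  rw [mul_apply_eq_comp, mul_apply_eq_comp, hC, hC, Dual.proj_incl, Dual.proj_incl] at h1
  exact h1

/-- The co-multiplication. -/
def comult : (VN (regularRep G)).toStarSubalgebra →⋆ₐ[ℂ] (VNSq (regularRep G)).toStarSubalgebra where
  toFun A := ⟨F.comultOp A, F.comultOp_mem A.2⟩
  map_one' := Subtype.ext F.comultOp_one
  map_mul' A B := Subtype.ext (F.comultOp_mul A B.2)
  map_zero' := Subtype.ext F.comultOp_zero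
  map_add' A B := Subtype.ext (F.comultOp_add A B)
  commutes' c := Subtype.ext <| by
    change F.comultOp (algebraMap ℂ _ c) = algebraMap ℂ _ c
    rw [Algebra.algebraMap_eq_smul_one, comultOp_smul, comultOp_one, Algebra.algebraMap_eq_smul_one]
  map_star' A := Subtype.ext (F.comultOp_star A)

theorem coe_comult (A : (VN (regularRep G)).toStarSubalgebra) :
    (F.comult A : HilbertSq (RegSpace G) →L[ℂ] HilbertSq (RegSpace G)) =
      F.comultOp (A : RegSpace G →L[ℂ] RegSpace G) := rfl

theorem inner_comultOp (A : RegSpace G →L[ℂ] RegSpace G) (x y : HilbertSq (RegSpace G)) :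
    ⟪x, F.comultOp A y⟫_ℂ =
      ∑' j, ⟪(F.cls j).incl (F.coord x j), A ((F.cls j).incl (F.coord y j))⟫_ℂ := by
  refine (inner_hilbertBlockOp F.isHilbertSum _ _ x y).trans (tsum_congr fun j => ?_)
  rw [Dual.inner_incl]
  rfl

theorem summable_incl_coord {x : ℕ → HilbertSq (RegSpace G)} (hx : Summable fun n => ‖x n‖ ^ 2) :
    Summable fun q : ℕ × F.J => ‖(F.cls q.2).incl (F.coord (x q.1) q.2)‖ ^ 2 := by
  rw [summable_prod_of_nonneg fun _ => sq_nonneg _]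
  simp only [Dual.norm_incl]
  refine ⟨fun n => summable_hilbertCoord F.isHilbertSum (x n), hx.congr fun n => ?_⟩
  exact (tsum_hilbertCoord F.isHilbertSum (x n)).symm

/-- This is normality: the pull-back of a w*-continuous functional is again given by two
square-summable families, now indexed by pairs of an integer and a summand. -/
theorem tsum_inner_comult (p : UltraweakIndex (HilbertSq (RegSpace G)))
    (A : RegSpace G →L[ℂ] RegSpace G) :
    ∑' n, ⟪p.1.1 n, F.comultOp A (p.1.2 n)⟫_ℂ = ∑' q : ℕ × F.J,
      ⟪(F.cls q.2).incl (F.coord (p.1.1 q.1) q.2),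
        A ((F.cls q.2).incl (F.coord (p.1.2 q.1) q.2))⟫_ℂ := by
  have hs : Summable fun q : ℕ × F.J => ⟪(F.cls q.2).incl (F.coord (p.1.1 q.1) q.2),
      A ((F.cls q.2).incl (F.coord (p.1.2 q.1) q.2))⟫_ℂ := by
    refine Summable.of_norm_bounded ((summable_mul_norm (F.summable_incl_coord p.2.1)
      (F.summable_incl_coord p.2.2)).mul_left ‖A‖) fun q => ?_
    refine (norm_inner_le_norm _ _).trans ?_
    rw [abs_norm, abs_norm, mul_left_comm]
    exact mul_le_mul_of_nonneg_left (A.le_opNorm _) (norm_nonneg _)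
  rw [hs.tsum_prod]
  exact tsum_congr fun n => F.inner_comultOp A _ _

theorem isComultiplication : IsComultiplication (regularRep G) F.comult where
  normal := by
    let := weakStarTopology (VN (regularRep G))
    refine continuous_to_weakStar fun p => ?_
    have h := continuous_weakStar_tsum (VN (regularRep G)) (F.summable_incl_coord p.2.1)
      (F.summable_incl_coord p.2.2)
    exact h.congr fun A => (F.tsum_inner_comult p A).symm
  map_lam s := F.comultOp_unitaryOp s

/-- Multiplication of the summands of `H ⊗₂ H` by scalars. -/
def scalarOp (c : F.J → ℝ) {C : ℝ} (hc : ∀ j, |c j| ≤ C) :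
    HilbertSq (RegSpace G) →L[ℂ] HilbertSq (RegSpace G) :=
  hilbertScalarOp F.isHilbertSum c hc

theorem scalarOp_apply {c : F.J → ℝ} {C : ℝ} (hc : ∀ j, |c j| ≤ C) (j : F.J)
    (v : EuclideanSpace ℂ (Fin (F.cls j).dim)) :
    F.scalarOp c hc (F.Q j v) = (c j : ℂ) • F.Q j v :=
  hilbertScalarOp_apply F.isHilbertSum hc j v

theorem coord_scalarOp {c : F.J → ℝ} {C : ℝ} (hc : ∀ j, |c j| ≤ C) (x : HilbertSq (RegSpace G))
    (j : F.J) : F.coord (F.scalarOp c hc x) j = (c j : ℂ) • F.coord x j :=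
  hilbertCoord_hilbertScalarOp F.isHilbertSum hc x j

theorem scalarOp_le_one {c : F.J → ℝ} {C : ℝ} (hc : ∀ j, |c j| ≤ C) (h : ∀ j, c j ≤ 1) :
    F.scalarOp c hc ≤ 1 :=
  hilbertScalarOp_le_one F.isHilbertSum hc h

theorem coord_comultOp_diagOp {f : Dual G → ℝ} {C : ℝ} (hf : ∀ π, |f π| ≤ C)
    (x : HilbertSq (RegSpace G)) (j : F.J) :
    F.coord (F.comultOp (diagOp f hf) x) j = (f (F.cls j) : ℂ) • F.coord x j := by
  rw [coord_comultOp, Dual.diagOp_incl, map_smul, Dual.proj_incl]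

/-- Every summand lies in the tensor product of one left and one right block, so a tensor product of
diagonal operators is scalar on it. -/
theorem coord_tensorOp_diagOp {f g : Dual G → ℝ} {C D : ℝ} (hf : ∀ π, |f π| ≤ C)
    (hg : ∀ π, |g π| ≤ D) (x : HilbertSq (RegSpace G)) (j : F.J) :
    F.coord (tensorOp (diagOp f hf) (diagOp g hg) x) j =
      ((f (F.left j).1 * g (F.right j).1 : ℝ) : ℂ) • F.coord x j := by
  have hc : ∀ j, |f (F.left j).1 * g (F.right j).1| ≤ C * D := fun j => by
    rw [abs_mul]
    exact mul_le_mul (hf _) (hg _) (abs_nonneg _) ((abs_nonneg _).trans (hf (F.cls j)))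
  have h : tensorOp (diagOp f hf) (diagOp g hg) =
      F.scalarOp (fun j => f (F.left j).1 * g (F.right j).1) hc :=
    F.ext fun j v => by rw [(F.isFusion j).tensorOp_diagOp, scalarOp_apply]
  rw [h, coord_scalarOp]

theorem hasSum_coord (x : HilbertSq (RegSpace G)) : HasSum (fun j => F.Q j (F.coord x j)) x :=
  hasSum_hilbertCoord F.isHilbertSum x

end FusionSystem

end Comultiplication

/-! ### Sufficiency of the inequality -/

noncomputable section Sufficiency

open Filter Topology

variable {G : Type u} [Group G] [TopologicalSpace G]

open scoped Classical in
/-- The scalars `f π` for `π ∈ S`, and `0` elsewhere. -/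
def truncate (f : Dual G → ℝ) (S : Finset (Dual G)) (π : Dual G) : ℝ := if π ∈ S then f π else 0

theorem truncate_of_mem (f : Dual G → ℝ) {S : Finset (Dual G)} {π : Dual G} (h : π ∈ S) :
    truncate f S π = f π := if_pos h

theorem truncate_of_notMem (f : Dual G → ℝ) {S : Finset (Dual G)} {π : Dual G} (h : π ∉ S) :
    truncate f S π = 0 := if_neg h

/-- $\omega$ may be unbounded; its truncation to a finite set of classes has this crude bound, which
makes $WE_S$ a bounded operator. -/
theorem abs_truncate_le (f : Dual G → ℝ) (S : Finset (Dual G)) (π : Dual G) :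
    |truncate f S π| ≤ ∑ σ ∈ S, |f σ| := by
  by_cases h : π ∈ S
  · rw [truncate_of_mem f h]
    exact Finset.single_le_sum (f := fun σ => |f σ|) (fun σ _ => abs_nonneg _) h
  · rw [truncate_of_notMem f h, abs_zero]
    exact Finset.sum_nonneg fun σ _ => abs_nonneg _

theorem abs_truncate_one_le (S : Finset (Dual G)) (π : Dual G) : |truncate 1 S π| ≤ 1 := by
  by_cases h : π ∈ S
  · rw [truncate_of_mem _ h]; simp
  · rw [truncate_of_notMem _ h]; simp

/-- The projection onto the blocks of the classes in `S`. -/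
def truncProj (S : Finset (Dual G)) : RegSpace G →L[ℂ] RegSpace G :=
  diagOp (truncate 1 S) (abs_truncate_one_le S)

/-- Multiplication by `ω` on the blocks of the classes in `S`. -/
def truncOp (ω : Dual G → ℝ) (S : Finset (Dual G)) : RegSpace G →L[ℂ] RegSpace G :=
  diagOp (truncate ω S) (abs_truncate_le ω S)

theorem truncProj_mul {S T : Finset (Dual G)} (h : S ⊆ T) :
    truncProj S * truncProj T = truncProj S := by
  refine diagOp_mul _ _ _ _ _ _ fun π => ?_
  by_cases hS : π ∈ S
  · rw [truncate_of_mem _ hS, truncate_of_mem _ (h hS)]; simp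
  · rw [truncate_of_notMem _ hS, zero_mul]

theorem isStarProjection_truncProj (S : Finset (Dual G)) :
    IsStarProjection (truncProj S : RegSpace G →L[ℂ] RegSpace G) :=
  ⟨truncProj_mul (Finset.Subset.refl S), isSelfAdjoint_diagOp _ _⟩

theorem truncProj_apply_eq_sum (S : Finset (Dual G)) (x : RegSpace G) :
    truncProj S x = ∑ π ∈ S, ∑ c : Fin π.dim, blockIncl RegBlock ⟨π, c⟩ (x ⟨π, c⟩) := by
  classical
  have h : ∑ π ∈ S, ∑ c : Fin π.dim, blockIncl RegBlock ⟨π, c⟩ (x ⟨π, c⟩) =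
      ∑ i ∈ S.sigma fun _ => Finset.univ, blockIncl RegBlock i (x i) :=
    (Finset.sum_sigma S (fun _ => Finset.univ) fun i : DualIndex G =>
      blockIncl RegBlock i (x i)).symm
  rw [h]
  ext i : 2
  rw [sum_blockIncl_apply, truncProj, diagOp_apply]
  by_cases hi : i.1 ∈ S
  · rw [truncate_of_mem _ hi, if_pos (by simpa using hi)]
    simp
  · rw [truncate_of_notMem _ hi, if_neg (by simpa using hi)]
    simp

theorem tendsto_truncProj (x : RegSpace G) :
    Tendsto (fun S : Finset (Dual G) => truncProj S x) atTop (𝓝 x) := by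
  have h : HasSum (fun π : Dual G => ∑ c : Fin π.dim, blockIncl RegBlock ⟨π, c⟩ (x ⟨π, c⟩)) x :=
    (hasSum_blockIncl x).sigma fun π => hasSum_fintype _
  exact h.congr fun S => (truncProj_apply_eq_sum S x).symm

theorem norm_diagOp_le (f : Dual G → ℝ) {K : ℝ} (hf : ∀ π, |f π| ≤ K) :
    ‖diagOp f hf‖ ≤ |K| := by
  rw [diagOp]
  exact lp.norm_mapCLM_le (E := RegBlock) (F := RegBlock) 2
    (fun i => (f i.1 : ℂ) • ContinuousLinearMap.id ℂ (RegBlock i)) (abs_nonneg K)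
    fun i => norm_ofReal_smul_id_le (hf i.1)

theorem norm_truncProj_le (S : Finset (Dual G)) :
    ‖(truncProj S : RegSpace G →L[ℂ] RegSpace G)‖ ≤ 1 :=
  (norm_diagOp_le _ (abs_truncate_one_le S)).trans abs_one.le

/-- `truncProj S` as an element of `VN(G)`. -/
def truncProjVN (S : Finset (Dual G)) : (VN (regularRep G)).toStarSubalgebra :=
  ⟨truncProj S, diagOp_mem_VN _ _⟩

/-- `truncOp ω S` as an element of `VN(G)`. -/
def truncOpVN (ω : Dual G → ℝ) (S : Finset (Dual G)) : (VN (regularRep G)).toStarSubalgebra :=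
  ⟨truncOp ω S, diagOp_mem_VN _ _⟩

theorem isExtendable_truncProj (F : FusionSystem G) (ω : Dual G → ℝ) :
    IsExtendable F.comult (centralOperator ω) truncProjVN (truncOpVN ω) where
  nonempty := inferInstance
  directed := inferInstance
  projection := isStarProjection_truncProj
  monotone S T h := ((isStarProjection_truncProj S).le_iff_mul_eq_left
    (isStarProjection_truncProj T)).2 (truncProj_mul h)
  dense_D x := mem_closure_of_tendsto (tendsto_truncProj x)
    (Eventually.of_forall fun S => Set.mem_iUnion.2 ⟨S, x, rfl⟩)
  closed := centralOperator_isClosed ω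
  mem_graph S x := by
    rw [mem_centralOperator_graph]
    intro i
    change (truncate ω S i.1 : ℂ) • x i = (ω i.1 : ℂ) • (truncate 1 S i.1 : ℂ) • x i
    by_cases hS : i.1 ∈ S
    · rw [truncate_of_mem _ hS, truncate_of_mem _ hS]; simp
    · rw [truncate_of_notMem _ hS, truncate_of_notMem _ hS]; simp
  selfAdjoint S := isSelfAdjoint_diagOp _ (abs_truncate_le ω S)
  dense_D' x := by
    classical
    refine mem_closure_of_tendsto (F.hasSum_coord x) (Eventually.of_forall fun T => ?_)
    -- A finite partial sum involves finitely many classes and is fixed by $\Gamma(E_S)$ for the set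
    -- $S$ of these classes.
    refine Set.mem_iUnion.2 ⟨T.image F.cls, ∑ j ∈ T, F.Q j (F.coord x j), ?_⟩
    rw [F.coe_comult, map_sum]
    refine Finset.sum_congr rfl fun j hj => F.coord_ext fun k => ?_
    refine (F.coord_comultOp_diagOp (abs_truncate_one_le (T.image F.cls)) _ k).trans ?_
    by_cases hk : k = j
    · subst hk
      rw [truncate_of_mem _ (Finset.mem_image_of_mem F.cls hj)]
      simp
    · rw [F.coord_Q_ne hk, smul_zero]

/-- The inverse of `centralOperator ω` as an element of `VN(G)`. -/
def invVN {δ : ℝ} (hδ : 0 < δ) {ω : Dual G → ℝ} (hω : ∀ π, δ < ω π) :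
    (VN (regularRep G)).toStarSubalgebra :=
  ⟨diagOp (fun π => (ω π)⁻¹) (abs_inv_le hδ hω), diagOp_mem_VN _ _⟩

variable {δ : ℝ} (hδ : 0 < δ) {ω : Dual G → ℝ} (hω : ∀ π, δ < ω π)

theorem truncOp_mul_inv (S : Finset (Dual G)) :
    truncOp ω S * diagOp (fun π => (ω π)⁻¹) (abs_inv_le hδ hω) = truncProj S := by
  refine diagOp_mul _ _ _ _ _ _ fun π => ?_
  by_cases hS : π ∈ S
  · rw [truncate_of_mem _ hS, truncate_of_mem _ hS, mul_inv_cancel₀ (hδ.trans (hω π)).ne']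
    rfl
  · rw [truncate_of_notMem _ hS, truncate_of_notMem _ hS, zero_mul]

/-- $AE_S=(A\,WE_S)W^{-1}$ is in the range, and $AE_S\to A$ strongly with norms bounded by $\|A\|$.
-/
theorem dense_range_mul_inv : @Dense _ (weakStarTopology (VN (regularRep G)))
    (Set.range fun A : (VN (regularRep G)).toStarSubalgebra => A * invVN hδ hω) := by
  intro A
  let := weakStarTopology (VN (regularRep G))
  have ht : Tendsto (fun S => A * truncProjVN S) atTop (𝓝 A) := by
    refine tendsto_weakStar_of_strong (C := ‖(A : RegSpace G →L[ℂ] RegSpace G)‖) (fun S => ?_)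
      fun x => ((A : RegSpace G →L[ℂ] RegSpace G).continuous.tendsto x).comp (tendsto_truncProj x)
    refine (norm_mul_le (A : RegSpace G →L[ℂ] RegSpace G) (truncProj S)).trans ?_
    exact mul_le_of_le_one_right (norm_nonneg _) (norm_truncProj_le S)
  refine mem_closure_of_tendsto ht (Eventually.of_forall fun S => ⟨A * truncOpVN ω S, ?_⟩)
  change A * truncOpVN ω S * invVN hδ hω = A * truncProjVN S
  rw [mul_assoc]
  congr 1
  exact Subtype.ext (truncOp_mul_inv hδ hω S)

theorem FusionSystem.mem_range_comult_iff (F : FusionSystem G) (S : Finset (Dual G))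
    (x : HilbertSq (RegSpace G)) :
    x ∈ Set.range (F.comult (truncProjVN S) : HilbertSq (RegSpace G) →L[ℂ] HilbertSq (RegSpace G)) ↔
      ∀ j, F.cls j ∉ S → F.coord x j = 0 := by
  constructor
  · rintro ⟨y, rfl⟩ j hj
    refine (F.coord_comultOp_diagOp (abs_truncate_one_le S) y j).trans ?_
    rw [truncate_of_notMem _ hj, Complex.ofReal_zero, zero_smul]
  · intro h
    refine ⟨x, F.coord_ext fun j => (F.coord_comultOp_diagOp (abs_truncate_one_le S) x j).trans ?_⟩
    by_cases hj : F.cls j ∈ S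
    · rw [truncate_of_mem _ hj]; simp
    · rw [h j hj, smul_zero]

/-- All operators in the definition are scalar on each summand. In particular $W^{-1}\otimes W^{-1}$
preserves the range of each $\Gamma(E_S)$, so $\mathcal D'\subseteq\mathcal D_0$. -/
theorem isWeightAlong_of_le (F : FusionSystem G)
    (h : ∀ σ π π' : Dual G, σ ∈ supp (π.rep.tensor π'.rep) → ω σ ≤ ω π * ω π') :
    IsWeightAlong (regularRep G) F.comult (centralOperator ω) truncProjVN (truncOpVN ω)
      (invVN hδ hω) where
  closed := centralOperator_isClosed ω
  dense_domain := centralOperator_dense_domain ω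
  positive := centralOperator_isPositive ω fun π => (hδ.trans (hω π)).le
  affiliated := isAffiliated_centralOperator hδ hω
  inverse := isBoundedInverse_diagOp hδ hω
  comultiplication := F.isComultiplication
  extendable := isExtendable_truncProj F ω
  dense_D₀ := by
    refine (isExtendable_truncProj F ω).dense_D'.mono fun x hx => ?_
    obtain ⟨S, hS⟩ := Set.mem_iUnion.1 hx
    refine Set.mem_iUnion.2 ⟨S, (F.mem_range_comult_iff S _).2 fun j hj => ?_⟩
    refine (F.coord_tensorOp_diagOp (abs_inv_le hδ hω) (abs_inv_le hδ hω) x j).trans ?_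
    rw [(F.mem_range_comult_iff S x).1 hS j hj, smul_zero]
  bounded_le_one := by
    -- `d j` is the eigenvalue of $W^{-1}\otimes W^{-1}$ on the summand `j`, and $T$ is
    -- multiplication by `ω (F.cls j) * d j`. The assumed inequality enters through `F.mem_supp`.
    let d : F.J → ℝ := fun j => (ω (F.left j).1)⁻¹ * (ω (F.right j).1)⁻¹
    have hpos : ∀ π, 0 < ω π := fun π => hδ.trans (hω π)
    have hd : ∀ j, 0 < d j := fun j => mul_pos (inv_pos.2 (hpos _)) (inv_pos.2 (hpos _))
    have hle : ∀ j, ω (F.cls j) * d j ≤ 1 := fun j => by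
      have h1 := mul_le_mul_of_nonneg_right (h _ _ _ (F.mem_supp j)) (hd j).le
      refine h1.trans (le_of_eq ?_)
      have := (hpos (F.left j).1).ne'
      have := (hpos (F.right j).1).ne'
      simp only [d]
      field_simp
    have hc : ∀ j, |ω (F.cls j) * d j| ≤ 1 := fun j => by
      rw [abs_of_pos (mul_pos (hpos _) (hd j))]
      exact hle j
    refine ⟨F.scalarOp (fun j => ω (F.cls j) * d j) hc, fun x hx => ?_, F.scalarOp_le_one hc hle⟩
    obtain ⟨S, hS⟩ := Set.mem_iUnion.1 hx
    have hcoord : ∀ j, F.coord (tensorOp (invVN hδ hω : RegSpace G →L[ℂ] RegSpace G)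
        (invVN hδ hω : RegSpace G →L[ℂ] RegSpace G) x) j = (d j : ℂ) • F.coord x j :=
      fun j => F.coord_tensorOp_diagOp (abs_inv_le hδ hω) (abs_inv_le hδ hω) x j
    refine (isExtendable_truncProj F ω).extensionGraph_le
      ((isExtendable_truncProj F ω).mem_extensionGraph.2 ⟨S, hS, F.coord_ext fun j => ?_⟩)
    refine (F.coord_scalarOp hc x j).trans (Eq.trans ?_
      (F.coord_comultOp_diagOp (abs_truncate_le ω S) _ j).symm)
    have h0 := (F.mem_range_comult_iff S _).1 hS j
    rw [hcoord] at h0 ⊢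
    by_cases hj : F.cls j ∈ S
    · rw [truncate_of_mem _ hj, smul_smul, Complex.ofReal_mul]
    -- Membership in $\mathcal D'$ is known for $(W^{-1}\otimes W^{-1})x$ only; since `d j` is
    -- nonzero, $x$ itself vanishes on the summands outside `S`.
    · have h2 : F.coord x j = 0 :=
        (smul_eq_zero.1 (h0 hj)).resolve_left (by exact_mod_cast (hd j).ne')
      rw [h2, smul_zero, smul_zero, smul_zero]
  dense_mul_inv := dense_range_mul_inv hδ hω

end Sufficiency


end BeurlingFourier

theorem mainTheorem11 {G : Type u} [Group G] [TopologicalSpace G] [IsTopologicalGroup G]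
    [CompactSpace G] (δ : ℝ) (hδ : 0 < δ) (ω : BeurlingFourier.Dual G → ℝ)
    (hω : ∀ π, δ < ω π) :
    BeurlingFourier.IsCentralWeight (BeurlingFourier.regularRep G)
        (BeurlingFourier.centralOperator ω) ↔
      ∀ σ π π' : BeurlingFourier.Dual G,
        σ ∈ BeurlingFourier.supp (π.rep.tensor π'.rep) → ω σ ≤ ω π * ω π' := by
  constructor
  · rintro ⟨Γ, ι, _, E, WE, Winv, h, -⟩ σ π π' hσ
    exact BeurlingFourier.le_mul_of_isWeightAlong hδ hω h hσ
  · intro h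
    obtain ⟨F⟩ := BeurlingFourier.nonempty_fusionSystem (G := G)
    exact ⟨F.comult, Finset (BeurlingFourier.Dual G), inferInstance, BeurlingFourier.truncProjVN,
      BeurlingFourier.truncOpVN ω, BeurlingFourier.invVN hδ hω,
      BeurlingFourier.isWeightAlong_of_le hδ hω F h,
      fun S => BeurlingFourier.diagOp_mem_commutant _
        (BeurlingFourier.abs_truncate_le ω S)⟩
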